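/- Let $M$ be a closed (compact, without boundary) oriented Riemannian spin manifold of even dimension $n=2m$, with a fixed spin structure and spinor bundle $S$ of rank $2^m$. Let $\gamma^a$ ($a=0,\dots,n-1$) be selfadjoint $2^m\times 2^m$ Dirac matrices, $\gamma^a\gamma^b+\gamma^b\gamma^a=2\delta^{ab}$, let $\gamma^\mu=e^\mu_a\gamma^a$ be the corresponding matrices in local coordinates ($e^\mu_a$ the coefficients of a local orthonormal frame), let $\gamma=\pm(-i)^m\gamma^0\cdots\gamma^{n-1}$ be the grading, and let $\mathcal J$ be the charge conjugation, i.e. the antiunitary operator on $L^2(M,S)$ which acts pointwise and satisfies $\mathcal J\gamma^\mu=-\gamma^\mu\mathcal J$. Let $\slashed\partial=-i\gamma^\mu\widetilde\nabla^S_\mu$ be the Dirac operator on $L^2(M,S)$, where $\widetilde\nabla^S$ is the lift to $S$ of the Levi-Civita connection (that is, the closure of this operator defined on smooth spinors). The algebra $C^\infty(M)\otimes\mathbb C^2$ of pairs of smooth complex functions acts on $L^2(M,S)$ by $\pi(f,g)=\frac{1+\gamma}{2}f+\frac{1-\gamma}{2}g$; put $(f,g)^*=(\bar f,\bar g)$,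 $\rho(f,g)=(g,f)$ and $a^+=\rho(a)^*$. An element $u$ is a twisted unitary if $u^+u=uu^+=1$. Put $\mathrm{Ad}(u)=\pi(u)\,\mathcal J\pi(u)\mathcal J^{-1}$. **Proposition.** Assume that the $KO$-dimension $2m \bmod 8$ is $0$ or $4$, and let $h\in C^\infty(M)$ be a complex-valued function that vanishes nowhere. Then $u_h=(h,1/\bar h)$ is a twisted unitary and $$\mathrm{Ad}(u_h)\,\slashed\partial\,\mathrm{Ad}(u_h)^\dagger=\slashed\partial-i\gamma^\mu f_\mu\,\gamma ,\qquad \omega_f:=f_\mu\,dx^\mu=d(\ln|h|^2),$$ as an equality of unbounded operators on $L^2(M,S)$, domains included; the same equality holds for the operators restricted to smooth spinors. -/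

import Mathlib

open Bundle MeasureTheory
open scoped Manifold ContDiff ENNReal

noncomputable section

namespace TwistedDirac

/-- Model space of a manifold of even dimension `2m`. -/
abbrev Model (m : ℕ) := EuclideanSpace ℝ (Fin (2 * m))

/-- Typical fibre `ℂ^(2^m)` of the spinor bundle in dimension `2m`. -/
abbrev Spinor (m : ℕ) := EuclideanSpace ℂ (Fin (2 ^ m))

/-- The `KO`-dimension of the canonical spectral triple of a spin manifold of dimension `2m`
is its dimension modulo `8`. -/
def koDimension (m : ℕ) : ℕ := (2 * m) % 8

/-! ### Dirac matrices, grading and charge conjugation -/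

/-- The Euclidean quadratic form `∑ₐ (vᵃ)²` on `ℝ^(2m)`. -/
def euclideanForm (m : ℕ) : QuadraticForm ℝ (Fin (2 * m) → ℝ) :=
  QuadraticMap.weightedSumSquares ℝ (fun _ => (1 : ℝ))

/-- Euclidean Dirac matrices in dimension `2m`, the grading, and the charge conjugation:
* `gamma a` are selfadjoint matrices of size `2^m` with `γᵃ γᵇ + γᵇ γᵃ = 2 δᵃᵇ`;
* `grading` is the chirality matrix `± (-i)^m γ⁰ ⋯ γ^(2m-1)` (either sign convention);
* `chargeConj` is an antiunitary operator on the fibre that anticommutes with the Dirac matrices. -/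
structure DiracMatrices (m : ℕ) where
  gamma : Fin (2 * m) → (Spinor m →L[ℂ] Spinor m)
  gamma_selfAdjoint : ∀ a, IsSelfAdjoint (gamma a)
  gamma_anticomm : ∀ a b,
    gamma a * gamma b + gamma b * gamma a = (if a = b then (2 : ℂ) else 0) • 1
  grading : Spinor m →L[ℂ] Spinor m
  grading_eq : grading = -((-Complex.I) ^ m • (List.ofFn gamma).prod) ∨
    grading = (-Complex.I) ^ m • (List.ofFn gamma).prod
  chargeConj : Spinor m ≃ₗᵢ⋆[ℂ] Spinor m
  chargeConj_gamma : ∀ a v, chargeConj (gamma a v) = -gamma a (chargeConj v)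

variable {m : ℕ}

namespace DiracMatrices

variable (R : DiracMatrices m)

/-- The Clifford action `v ↦ ∑ₐ vᵃ γᵃ` of `ℝ^(2m)`. -/
def vec : (Fin (2 * m) → ℝ) →ₗ[ℝ] (Spinor m →L[ℂ] Spinor m) where
  toFun v := ∑ a, ((v a : ℝ) : ℂ) • R.gamma a
  map_add' v w := by
    rw [← Finset.sum_add_distrib]
    refine Finset.sum_congr rfl fun a _ => ?_
    rw [Pi.add_apply, Complex.ofReal_add]
    exact add_smul (v a : ℂ) (w a : ℂ) (R.gamma a)
  map_smul' c v := by
    ext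
    simp [Finset.smul_sum, mul_smul]

theorem vec_mul_self (v : Fin (2 * m) → ℝ) :
    R.vec v * R.vec v = algebraMap ℝ _ (euclideanForm m v) := by
  have h1 : (2 : ℂ) • (R.vec v * R.vec v) =
      ∑ a, ∑ b, (((v a : ℝ) : ℂ) * ((v b : ℝ) : ℂ)) •
        (R.gamma a * R.gamma b + R.gamma b * R.gamma a) := by
    have e1 : R.vec v * R.vec v = ∑ a, ∑ b, (((v a : ℝ) : ℂ) * ((v b : ℝ) : ℂ)) •
        (R.gamma a * R.gamma b) := by
      simp only [vec, LinearMap.coe_mk, AddHom.coe_mk, Finset.sum_mul_sum]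
      refine Finset.sum_congr rfl fun a _ => Finset.sum_congr rfl fun b _ => ?_
      rw [smul_mul_smul_comm]
    have e2 : R.vec v * R.vec v = ∑ a, ∑ b, (((v a : ℝ) : ℂ) * ((v b : ℝ) : ℂ)) •
        (R.gamma b * R.gamma a) := by
      rw [e1, Finset.sum_comm]
      refine Finset.sum_congr rfl fun a _ => Finset.sum_congr rfl fun b _ => ?_
      rw [mul_comm ((v b : ℝ) : ℂ)]
    simp only [smul_add, Finset.sum_add_distrib]
    rw [← e1, ← e2, two_smul ℂ (R.vec v * R.vec v)]
  have h2 : (2 : ℂ) • (R.vec v * R.vec v) =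
      (2 : ℂ) • (algebraMap ℝ (Spinor m →L[ℂ] Spinor m) (euclideanForm m v)) := by
    rw [h1]
    simp only [R.gamma_anticomm, smul_smul, ← Finset.sum_smul, mul_ite, mul_zero,
      Finset.sum_ite_eq, Finset.mem_univ, if_true]
    ext ψ i
    simp [euclideanForm, QuadraticMap.weightedSumSquares_apply, Algebra.algebraMap_eq_smul_one,
      Finset.mul_sum, Finset.sum_mul]
    exact Finset.sum_congr rfl fun a _ => by ring
  exact smul_right_injective _ (two_ne_zero) h2

/-- The spin representation: the Clifford algebra acting on the fibre through the Dirac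
matrices. -/
def rep : CliffordAlgebra (euclideanForm m) →ₐ[ℝ] (Spinor m →L[ℂ] Spinor m) :=
  CliffordAlgebra.lift (euclideanForm m) ⟨R.vec, R.vec_mul_self⟩

/-- Projection on positive chirality, `(1 + γ)/2`. -/
def projPos : Spinor m →L[ℂ] Spinor m := (2⁻¹ : ℂ) • (1 + R.grading)

/-- Projection on negative chirality, `(1 - γ)/2`. -/
def projNeg : Spinor m →L[ℂ] Spinor m := (2⁻¹ : ℂ) • (1 - R.grading)

end DiracMatrices

/-! ### Riemannian volume and Levi-Civita connection -/

section Manifold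

variable (M : Type*) [TopologicalSpace M] [ChartedSpace (Model m) M]
  [IsManifold 𝓘(ℝ, Model m) ∞ M]
  [RiemannianBundle (fun x : M => TangentSpace 𝓘(ℝ, Model m) x)]

variable {M} in
/-- `√(det g_{μν})` in the chart `e`, as a function of the coordinates. -/
def volumeDensity (e : OpenPartialHomeomorph M (Model m)) (y : Model m) : ℝ :=
  let coordVector (μ : Fin (2 * m)) : TangentSpace 𝓘(ℝ, Model m) (e.symm y) :=
    mfderiv 𝓘(ℝ, Model m) 𝓘(ℝ, Model m) e.symm y (EuclideanSpace.single μ (1 : ℝ) : Model m)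
  Real.sqrt (Matrix.det (Matrix.of fun μ ν => inner ℝ (coordVector μ) (coordVector ν)))

variable (m) in
/-- The Riemannian volume measure. In each chart it is `√(det g) dx¹ ⋯ dxⁿ`; these local
measures agree on overlaps, and the measure glued from them is their supremum. -/
def riemannianVolume [MeasurableSpace M] : Measure M :=
  ⨆ e ∈ atlas (Model m) M,
    ((volume.withDensity fun y => ENNReal.ofReal (volumeDensity e y)).restrict e.target).map e.symm

variable {M}

/-- The Levi-Civita connection: the metric connection with vanishing torsion. -/
def IsLeviCivita [IsContMDiffRiemannianBundle 𝓘(ℝ, Model m) ∞ (Model m)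
      (fun x : M => TangentSpace 𝓘(ℝ, Model m) x)]
    (cov : CovariantDerivative 𝓘(ℝ, Model m) (Model m)
      (fun x : M => TangentSpace 𝓘(ℝ, Model m) x)) : Prop :=
  haveI : IsContMDiffRiemannianBundle 𝓘(ℝ, Model m) 1 (Model m)
    (fun x : M => TangentSpace 𝓘(ℝ, Model m) x) :=
    IsContMDiffRiemannianBundle.of_le (n := ∞) (by simp)
  cov.IsMetricCompatible ∧ ∀ x, cov.torsion x = 0

end Manifold

/-! ### Spin structures and spinor fields -/

/-- A spin structure on a (compact) Riemannian manifold, as a lift to `Spin(2m)` of the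
transition functions of the bundle of oriented orthonormal frames.

`M` is covered by finitely many open sets `U i` carrying smooth orthonormal frames `frame i`;
on overlaps `lift i j x ∈ Spin(2m)` satisfies the cocycle relation and covers the change of frame
`frame j b = ∑ₐ ⟨frame i a, frame j b⟩ frame i a`. In particular the changes of frame lie in
`SO(2m)`: the orientation is the one for which all frames are oriented. -/
structure SpinStructure (R : DiracMatrices m) (M : Type*) [TopologicalSpace M]
    [ChartedSpace (Model m) M] [IsManifold 𝓘(ℝ, Model m) ∞ M]
    [RiemannianBundle (fun x : M => TangentSpace 𝓘(ℝ, Model m) x)] where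
  k : ℕ
  U : Fin k → Set M
  isOpen_U : ∀ i, IsOpen (U i)
  cover : ∀ x, ∃ i, x ∈ U i
  frame : Fin k → Fin (2 * m) → (x : M) → TangentSpace 𝓘(ℝ, Model m) x
  frame_smooth : ∀ i a, ContMDiffOn 𝓘(ℝ, Model m) (𝓘(ℝ, Model m).prod 𝓘(ℝ, Model m)) ∞
    (fun x => (⟨x, frame i a x⟩ : TangentBundle 𝓘(ℝ, Model m) M)) (U i)
  frame_orthonormal : ∀ i, ∀ x ∈ U i, Orthonormal ℝ (fun a => frame i a x)
  lift : Fin k → Fin k → M → CliffordAlgebra (euclideanForm m)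
  lift_mem : ∀ i j, ∀ x ∈ U i ∩ U j, lift i j x ∈ spinGroup (euclideanForm m)
  lift_smooth : ∀ i j, ContMDiffOn 𝓘(ℝ, Model m) 𝓘(ℝ, Spinor m →L[ℂ] Spinor m) ∞
    (fun x => R.rep (lift i j x)) (U i ∩ U j)
  lift_self : ∀ i, ∀ x ∈ U i, lift i i x = 1
  lift_cocycle : ∀ i j l, ∀ x ∈ U i ∩ U j ∩ U l, lift i j x * lift j l x = lift i l x
  lift_covers : ∀ i j, ∀ x ∈ U i ∩ U j, ∀ b,
    lift i j x * CliffordAlgebra.ι (euclideanForm m) (Pi.single b 1) =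
      (∑ a, (inner ℝ (frame i a x) (frame j b x) : ℝ) •
        CliffordAlgebra.ι (euclideanForm m) (Pi.single a 1)) * lift i j x

section Spinors

variable {R : DiracMatrices m} {M : Type*} [TopologicalSpace M] [ChartedSpace (Model m) M]
  [IsManifold 𝓘(ℝ, Model m) ∞ M]
  [RiemannianBundle (fun x : M => TangentSpace 𝓘(ℝ, Model m) x)]

namespace SpinStructure

variable (S : SpinStructure R M)

/-- The first frame of the cover that is defined at `x`. It identifies the fibre at `x` of the
spinor bundle with `Spinor m`, so that sections of the spinor bundle are functions
`ψ : M → Spinor m`, `ψ x` being the components of the section in this frame. -/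
def idx (x : M) : Fin S.k :=
  (wellFounded_lt (α := Fin S.k)).min {i | x ∈ S.U i} (S.cover x)

theorem mem_idx (x : M) : x ∈ S.U (S.idx x) :=
  (wellFounded_lt (α := Fin S.k)).min_mem {i | x ∈ S.U i} (S.cover x)

/-- Components in the `i`-th frame of the section `ψ` of the spinor bundle (relevant on `U i`). -/
def inFrame (i : Fin S.k) (ψ : M → Spinor m) (x : M) : Spinor m :=
  R.rep (S.lift i (S.idx x) x) (ψ x)

/-- Smooth sections of the spinor bundle. -/
def IsSmooth (ψ : M → Spinor m) : Prop :=
  ∀ i, ContMDiffOn 𝓘(ℝ, Model m) 𝓘(ℝ, Spinor m) ∞ (S.inFrame i ψ) (S.U i)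

/-- Clifford action `γ^μ η_μ = γᵃ η(E_a)` of the covector `η` at `x`. -/
def cliff (x : M) (η : TangentSpace 𝓘(ℝ, Model m) x →L[ℝ] ℝ) : Spinor m →L[ℂ] Spinor m :=
  ∑ a, ((η (S.frame (S.idx x) a x) : ℝ) : ℂ) • R.gamma a

variable (cov : CovariantDerivative 𝓘(ℝ, Model m) (Model m)
  (fun x : M => TangentSpace 𝓘(ℝ, Model m) x))

/-- The lift to spinors of the connection `cov`, in the direction `v` at `x`, with components in
the frame `(E_a)` of index `idx x`:
`∇^S_v ψ = v(ψ) + 1/4 ∑_{b,c} ⟨∇_v E_c, E_b⟩ γᵇ γᶜ ψ`. -/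
def spinCov (ψ : M → Spinor m) (x : M) (v : TangentSpace 𝓘(ℝ, Model m) x) : Spinor m :=
  mvfderiv 𝓘(ℝ, Model m) (S.inFrame (S.idx x) ψ) x v +
    (4⁻¹ : ℂ) • ∑ b, ∑ c,
      ((inner ℝ (cov (S.frame (S.idx x) c) x v) (S.frame (S.idx x) b x) : ℝ) : ℂ) •
        R.gamma b (R.gamma c (ψ x))

/-- The Dirac operator `-i γ^μ ∇^S_μ = -i γᵃ ∇^S_{E_a}` on sections of the spinor bundle. -/
def diracSection (ψ : M → Spinor m) (x : M) : Spinor m :=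
  (-Complex.I) • ∑ a, R.gamma a (S.spinCov cov ψ x (S.frame (S.idx x) a x))

variable {S}

theorem inFrame_idx (ψ : M → Spinor m) (x : M) : S.inFrame (S.idx x) ψ x = ψ x := by
  simp [inFrame, S.lift_self _ _ (S.mem_idx x)]

theorem inFrame_add (i : Fin S.k) (ψ φ : M → Spinor m) :
    S.inFrame i (ψ + φ) = S.inFrame i ψ + S.inFrame i φ := by
  ext1 x; simp [inFrame]

theorem inFrame_smul (i : Fin S.k) (c : ℂ) (ψ : M → Spinor m) :
    S.inFrame i (c • ψ) = c • S.inFrame i ψ := by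
  ext1 x; simp [inFrame]

theorem IsSmooth.add {ψ φ : M → Spinor m} (hψ : S.IsSmooth ψ) (hφ : S.IsSmooth φ) :
    S.IsSmooth (ψ + φ) := fun i => by
  rw [inFrame_add]; exact (hψ i).add (hφ i)

theorem IsSmooth.const_smul {ψ : M → Spinor m} (hψ : S.IsSmooth ψ) (c : ℂ) :
    S.IsSmooth (c • ψ) := fun i => by
  rw [inFrame_smul]
  exact (ContinuousLinearMap.contMDiff
    ((c • (1 : Spinor m →L[ℂ] Spinor m)).restrictScalars ℝ)).comp_contMDiffOn (hψ i)

theorem IsSmooth.zero : S.IsSmooth (0 : M → Spinor m) := fun i => by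
  have : S.inFrame i (0 : M → Spinor m) = fun _ => 0 := by ext1 x; simp [inFrame]
  rw [this]; exact contMDiffOn_const

theorem IsSmooth.mdifferentiableAt {ψ : M → Spinor m} (hψ : S.IsSmooth ψ) {i : Fin S.k} {x : M}
    (hx : x ∈ S.U i) :
    MDifferentiableAt 𝓘(ℝ, Model m) 𝓘(ℝ, Spinor m) (S.inFrame i ψ) x :=
  ((hψ i).contMDiffAt ((S.isOpen_U i).mem_nhds hx)).mdifferentiableAt (by simp)

theorem diracSection_add {ψ φ : M → Spinor m} (hψ : S.IsSmooth ψ) (hφ : S.IsSmooth φ) :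
    S.diracSection cov (ψ + φ) = S.diracSection cov ψ + S.diracSection cov φ := by
  ext1 x
  have h : mvfderiv 𝓘(ℝ, Model m) (S.inFrame (S.idx x) (ψ + φ)) x =
      mvfderiv 𝓘(ℝ, Model m) (S.inFrame (S.idx x) ψ) x +
        mvfderiv 𝓘(ℝ, Model m) (S.inFrame (S.idx x) φ) x := by
    rw [inFrame_add]
    exact mvfderiv_add (hψ.mdifferentiableAt (S.mem_idx x)) (hφ.mdifferentiableAt (S.mem_idx x))
  simp only [diracSection, spinCov, Pi.add_apply, h, add_apply, map_add,
    smul_add, Finset.sum_add_distrib]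
  abel

theorem diracSection_smul {ψ : M → Spinor m} (hψ : S.IsSmooth ψ) (c : ℂ) :
    S.diracSection cov (c • ψ) = c • S.diracSection cov ψ := by
  ext1 x
  have h : ∀ v, mvfderiv 𝓘(ℝ, Model m) (S.inFrame (S.idx x) (c • ψ)) x v =
      c • mvfderiv 𝓘(ℝ, Model m) (S.inFrame (S.idx x) ψ) x v := by
    intro v
    have hd := hψ.mdifferentiableAt (S.mem_idx x)
    have hc : HasMFDerivAt 𝓘(ℝ, Model m) 𝓘(ℝ, Spinor m) (c • S.inFrame (S.idx x) ψ) x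
        (((c • (1 : Spinor m →L[ℂ] Spinor m)).restrictScalars ℝ).comp
          (mvfderiv 𝓘(ℝ, Model m) (S.inFrame (S.idx x) ψ) x)) :=
      ((c • (1 : Spinor m →L[ℂ] Spinor m)).restrictScalars ℝ).hasMFDerivAt.comp x hd.hasMFDerivAt
    rw [inFrame_smul]
    change (mfderiv 𝓘(ℝ, Model m) 𝓘(ℝ, Spinor m) (c • S.inFrame (S.idx x) ψ) x) v = _
    rw [hc.mfderiv]
    rfl
  have h2 : ∀ v, S.spinCov cov (c • ψ) x v = c • S.spinCov cov ψ x v := by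
    intro v
    simp only [spinCov, Pi.smul_apply, h, map_smul]
    rw [smul_add, smul_comm c, Finset.smul_sum (r := c)]
    refine congrArg _ (congrArg _ (Finset.sum_congr rfl fun b _ => ?_))
    rw [Finset.smul_sum]
    exact Finset.sum_congr rfl fun d _ => smul_comm _ _ _
  simp only [diracSection, Pi.smul_apply, h2, map_smul]
  rw [← Finset.smul_sum, smul_comm]

theorem diracSection_zero : S.diracSection cov (0 : M → Spinor m) = 0 := by
  have := diracSection_smul (S := S) cov IsSmooth.zero 0
  simpa using this

end SpinStructure

/-! ### The Hilbert space of square integrable spinors and the operators on it -/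

variable [MeasurableSpace M] (S : SpinStructure R M)

/-- The Hilbert space `L²(M, S)`. The argument `S` fixes the identification of sections of the
spinor bundle with functions `M → Spinor m`; changes of frame are unitary. -/
abbrev L2Spinor (_S : SpinStructure R M) := Lp (Spinor m) 2 (riemannianVolume m M)

variable (cov : CovariantDerivative 𝓘(ℝ, Model m) (Model m)
  (fun x : M => TangentSpace 𝓘(ℝ, Model m) x))

/-- Graph of the Dirac operator on smooth spinors. (On a closed manifold the image of a smooth
spinor is again smooth, hence square integrable.) -/
def diracGraph : Submodule ℂ (L2Spinor S × L2Spinor S) where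
  carrier := {p | ∃ ψ : M → Spinor m, S.IsSmooth ψ ∧
    p.1 =ᵐ[riemannianVolume m M] ψ ∧ p.2 =ᵐ[riemannianVolume m M] S.diracSection cov ψ}
  add_mem' := by
    rintro p q ⟨ψ, hψ, h1, h2⟩ ⟨φ, hφ, h3, h4⟩
    refine ⟨ψ + φ, hψ.add hφ, ?_, ?_⟩
    · exact (Lp.coeFn_add _ _).trans (h1.add h3)
    · rw [SpinStructure.diracSection_add cov hψ hφ]
      exact (Lp.coeFn_add _ _).trans (h2.add h4)
  zero_mem' := by
    refine ⟨0, SpinStructure.IsSmooth.zero, Lp.coeFn_zero _ _ _, ?_⟩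
    rw [SpinStructure.diracSection_zero]
    exact Lp.coeFn_zero _ _ _
  smul_mem' := by
    rintro c p ⟨ψ, hψ, h1, h2⟩
    refine ⟨c • ψ, hψ.const_smul c, ?_, ?_⟩
    · exact (Lp.coeFn_smul _ _).trans (h1.const_smul c)
    · rw [SpinStructure.diracSection_smul cov hψ]
      exact (Lp.coeFn_smul _ _).trans (h2.const_smul c)

/-- The Dirac operator on the space of smooth spinors, as an unbounded operator on `L²(M, S)`.
It is single-valued: see `diracGraph_functional`. -/
def diracSmooth : L2Spinor S →ₗ.[ℂ] L2Spinor S := (diracGraph S cov).toLinearPMap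

/-- The Dirac operator of `M`: the closure of its restriction to smooth spinors. -/
def dirac : L2Spinor S →ₗ.[ℂ] L2Spinor S := (diracSmooth S cov).closure

theorem apply_add_ae (A : M → (Spinor m →L[ℂ] Spinor m)) (ψ φ : L2Spinor S) :
    (fun x => A x ((ψ + φ : L2Spinor S) x)) =ᵐ[riemannianVolume m M]
      (fun x => A x (ψ x)) + fun x => A x (φ x) := by
  filter_upwards [Lp.coeFn_add ψ φ] with x hx
  rw [hx, Pi.add_apply, map_add, Pi.add_apply]

theorem apply_smul_ae (A : M → (Spinor m →L[ℂ] Spinor m)) (c : ℂ) (ψ : L2Spinor S) :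
    (fun x => A x ((c • ψ : L2Spinor S) x)) =ᵐ[riemannianVolume m M]
      c • fun x => A x (ψ x) := by
  filter_upwards [Lp.coeFn_smul c ψ] with x hx
  rw [hx, Pi.smul_apply, map_smul, Pi.smul_apply]

/-- The square integrable spinor `x ↦ A x (ψ x)`. -/
def applyLp (A : M → (Spinor m →L[ℂ] Spinor m)) (ψ : L2Spinor S)
    (h : MemLp (fun x => A x (ψ x)) 2 (riemannianVolume m M)) : L2Spinor S :=
  h.toLp fun x => A x (ψ x)

theorem applyLp_add (A : M → (Spinor m →L[ℂ] Spinor m)) (ψ φ : L2Spinor S)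
    (h1 : MemLp (fun x => A x (ψ x)) 2 (riemannianVolume m M))
    (h2 : MemLp (fun x => A x (φ x)) 2 (riemannianVolume m M))
    (h3 : MemLp (fun x => A x ((ψ + φ : L2Spinor S) x)) 2 (riemannianVolume m M)) :
    applyLp S A (ψ + φ) h3 = applyLp S A ψ h1 + applyLp S A φ h2 :=
  (MemLp.toLp_congr h3 (h1.add h2) (apply_add_ae S A ψ φ)).trans (MemLp.toLp_add h1 h2)

theorem applyLp_smul (A : M → (Spinor m →L[ℂ] Spinor m)) (c : ℂ) (ψ : L2Spinor S)
    (h1 : MemLp (fun x => A x (ψ x)) 2 (riemannianVolume m M))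
    (h2 : MemLp (fun x => A x ((c • ψ : L2Spinor S) x)) 2 (riemannianVolume m M)) :
    applyLp S A (c • ψ) h2 = c • applyLp S A ψ h1 :=
  (MemLp.toLp_congr h2 (h1.const_smul c) (apply_smul_ae S A c ψ)).trans
    (MemLp.toLp_const_smul c h1)

/-- The square integrable spinors `ψ` such that `A ψ` is square integrable. -/
def mulDomain (A : M → (Spinor m →L[ℂ] Spinor m)) : Submodule ℂ (L2Spinor S) where
  carrier := {ψ | MemLp (fun x => A x (ψ x)) 2 (riemannianVolume m M)}
  add_mem' {ψ φ} hψ hφ := (memLp_congr_ae (apply_add_ae S A ψ φ)).2 (hψ.add hφ)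
  zero_mem' := by
    refine (memLp_congr_ae ?_).2 (MemLp.zero (ε := Spinor m))
    filter_upwards [Lp.coeFn_zero (Spinor m) 2 (riemannianVolume m M)] with x hx
    rw [hx, Pi.zero_apply, map_zero]
  smul_mem' c ψ hψ := (memLp_congr_ae (apply_smul_ae S A c ψ)).2 (hψ.const_smul c)

/-- Multiplication by a field of matrices, with its maximal domain. -/
def mulOp (A : M → (Spinor m →L[ℂ] Spinor m)) : L2Spinor S →ₗ.[ℂ] L2Spinor S where
  domain := mulDomain S A
  toFun :=
    { toFun := fun ψ => applyLp S A ψ.1 ψ.2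
      map_add' := fun ψ φ => applyLp_add S A ψ.1 φ.1 ψ.2 φ.2 (ψ + φ).2
      map_smul' := fun c ψ => applyLp_smul S A c ψ.1 ψ.2 (c • ψ).2 }

theorem memLp_apply [CompactSpace M] [BorelSpace M] (A : C(M, Spinor m →L[ℂ] Spinor m))
    (ψ : L2Spinor S) : MemLp (fun x => A x (ψ x)) 2 (riemannianVolume m M) := by
  refine MemLp.of_le_mul (c := ‖A‖) (Lp.memLp ψ) ?_ ?_
  · exact (ContinuousLinearMap.id ℂ
      (Spinor m →L[ℂ] Spinor m)).aestronglyMeasurable_comp₂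
        A.continuous.aestronglyMeasurable (Lp.aestronglyMeasurable ψ)
  · exact Filter.Eventually.of_forall fun x =>
      ((A x).le_opNorm _).trans (mul_le_mul_of_nonneg_right (A.norm_coe_le_norm x) (norm_nonneg _))

/-- Multiplication by a continuous field of matrices on a compact manifold, as a bounded
operator. -/
def mulCLM [CompactSpace M] [BorelSpace M] (A : C(M, Spinor m →L[ℂ] Spinor m)) :
    L2Spinor S →L[ℂ] L2Spinor S :=
  LinearMap.mkContinuous
    { toFun := fun ψ => applyLp S A ψ (memLp_apply S A ψ)
      map_add' := fun ψ φ => applyLp_add S A ψ φ _ _ _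
      map_smul' := fun c ψ => applyLp_smul S A c ψ _ _ }
    ‖A‖ (by
      intro ψ
      refine Lp.norm_le_mul_norm_of_ae_le_mul ?_
      filter_upwards [MemLp.coeFn_toLp (memLp_apply S A ψ)] with x hx
      refine (le_of_eq (congrArg norm hx)).trans ?_
      exact ((A x).le_opNorm _).trans
        (mul_le_mul_of_nonneg_right (A.norm_coe_le_norm x) (norm_nonneg _)))

/-- Pointwise application of an antiunitary operator of the fibre. -/
def pointwiseConj (J : Spinor m ≃ₗᵢ⋆[ℂ] Spinor m) : L2Spinor S →ₗ⋆[ℂ] L2Spinor S where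
  toFun ψ := J.toContinuousLinearEquiv.toContinuousLinearMap.compLp ψ
  map_add' ψ φ := by
    refine Lp.ext ?_
    filter_upwards [J.toContinuousLinearEquiv.toContinuousLinearMap.coeFn_compLp (ψ + φ),
      J.toContinuousLinearEquiv.toContinuousLinearMap.coeFn_compLp ψ,
      J.toContinuousLinearEquiv.toContinuousLinearMap.coeFn_compLp φ,
      Lp.coeFn_add ψ φ,
      Lp.coeFn_add (J.toContinuousLinearEquiv.toContinuousLinearMap.compLp ψ)
        (J.toContinuousLinearEquiv.toContinuousLinearMap.compLp φ)] with x h1 h2 h3 h4 h5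
    rw [h1, h5, Pi.add_apply, h2, h3, h4, Pi.add_apply, map_add]
  map_smul' c ψ := by
    refine Lp.ext ?_
    filter_upwards [J.toContinuousLinearEquiv.toContinuousLinearMap.coeFn_compLp (c • ψ),
      J.toContinuousLinearEquiv.toContinuousLinearMap.coeFn_compLp ψ,
      Lp.coeFn_smul c ψ,
      Lp.coeFn_smul (starRingEnd ℂ c) (J.toContinuousLinearEquiv.toContinuousLinearMap.compLp ψ)]
      with x h1 h2 h3 h4
    rw [h1, h4, Pi.smul_apply, h2, h3, Pi.smul_apply]
    exact J.toLinearEquiv.map_smulₛₗ c _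

theorem pointwiseConj_coeFn (J : Spinor m ≃ₗᵢ⋆[ℂ] Spinor m) (ψ : L2Spinor S) :
    pointwiseConj S J ψ =ᵐ[riemannianVolume m M] fun x => J (ψ x) :=
  J.toContinuousLinearEquiv.toContinuousLinearMap.coeFn_compLp ψ

theorem pointwiseConj_symm (J : Spinor m ≃ₗᵢ⋆[ℂ] Spinor m) (ψ : L2Spinor S) :
    pointwiseConj S J.symm (pointwiseConj S J ψ) = ψ := by
  refine Lp.ext ?_
  filter_upwards [pointwiseConj_coeFn S J.symm (pointwiseConj S J ψ),
    pointwiseConj_coeFn S J ψ] with x h1 h2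
  rw [h1, h2, LinearIsometryEquiv.symm_apply_apply]

/-- The real structure `𝒥` of `L²(M, S)`: the antiunitary operator that acts pointwise by charge
conjugation. -/
def realStructure : L2Spinor S ≃ₗᵢ⋆[ℂ] L2Spinor S where
  toLinearMap := pointwiseConj S R.chargeConj
  invFun := pointwiseConj S R.chargeConj.symm
  left_inv ψ := pointwiseConj_symm S R.chargeConj ψ
  right_inv ψ := by
    simpa using pointwiseConj_symm S R.chargeConj.symm ψ
  norm_map' ψ := by
    have h : ∀ᵐ x ∂riemannianVolume m M, ‖pointwiseConj S R.chargeConj ψ x‖ = ‖ψ x‖ := by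
      filter_upwards [pointwiseConj_coeFn S R.chargeConj ψ] with x hx
      rw [hx, LinearIsometryEquiv.norm_map]
    exact le_antisymm (Lp.norm_le_norm_of_ae_le (h.mono fun x hx => hx.le))
      (Lp.norm_le_norm_of_ae_le (h.mono fun x hx => hx.ge))

end Spinors

/-! ### The minimal twist -/

section Twist

/-- The algebra `C^∞(M)` of smooth complex functions. -/
abbrev SmoothFun (m : ℕ) (M : Type*) [TopologicalSpace M] [ChartedSpace (Model m) M] :=
  C^∞⟮𝓘(ℝ, Model m), M; 𝓘(ℝ, ℂ), ℂ⟯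

/-- The algebra `C^∞(M) ⊗ ℂ²`, as pairs of smooth functions. -/
abbrev TwistAlg (m : ℕ) (M : Type*) [TopologicalSpace M] [ChartedSpace (Model m) M] :=
  SmoothFun m M × SmoothFun m M

variable {M : Type*} [TopologicalSpace M] [ChartedSpace (Model m) M]

instance : ContMDiffRing 𝓘(ℝ, ℂ) ∞ ℂ where
  contMDiff_mul := by
    rw [← modelWithCornersSelf_prod, chartedSpaceSelf_prod]
    exact contDiff_mul.contMDiff

/-- Complex conjugate of a smooth function. -/
def conjFun (f : SmoothFun m M) : SmoothFun m M :=
  ⟨fun x => starRingEnd ℂ (f x), Complex.conjCLE.contDiff.contMDiff.comp f.contMDiff⟩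

/-- Inverse of a nowhere vanishing smooth function. -/
def invFun (f : SmoothFun m M) (hf : ∀ x, f x ≠ 0) : SmoothFun m M :=
  ⟨fun x => (f x)⁻¹, fun x =>
    ContDiffAt.comp_contMDiffAt (g := fun z : ℂ => z⁻¹) (contDiffAt_inv ℝ (hf x))
      (f.contMDiff x)⟩

/-- The involution `(f, g)* = (f̄, ḡ)`. -/
def starAlg (a : TwistAlg m M) : TwistAlg m M := (conjFun a.1, conjFun a.2)

/-- The twisting automorphism `ρ(f, g) = (g, f)`. -/
def twist (a : TwistAlg m M) : TwistAlg m M := (a.2, a.1)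

/-- The twisted involution `a⁺ = ρ(a)*`. -/
def plusAlg (a : TwistAlg m M) : TwistAlg m M := starAlg (twist a)

/-- Twisted unitaries of `C^∞(M) ⊗ ℂ²`. -/
def IsTwistedUnitary (u : TwistAlg m M) : Prop := plusAlg u * u = 1 ∧ u * plusAlg u = 1

/-- `u_h = (h, 1 / h̄)` for `h` nowhere vanishing. -/
def twistedUnitary (h : SmoothFun m M) (hh : ∀ x, h x ≠ 0) : TwistAlg m M :=
  (h, invFun (conjFun h) fun x => by
    change starRingEnd ℂ (h x) ≠ 0
    simpa using hh x)

variable {R : DiracMatrices m} [IsManifold 𝓘(ℝ, Model m) ∞ M]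
  [RiemannianBundle (fun x : M => TangentSpace 𝓘(ℝ, Model m) x)]
  [MeasurableSpace M] (S : SpinStructure R M)

/-- The representation `π(f, g) = f (1 + γ)/2 + g (1 - γ)/2` on `L²(M, S)`. -/
def repAlg [CompactSpace M] [BorelSpace M] (a : TwistAlg m M) : L2Spinor S →L[ℂ] L2Spinor S :=
  mulCLM S
    ⟨fun x => a.1 x • R.projPos + a.2 x • R.projNeg,
      (a.1.contMDiff.continuous.smul continuous_const).add
        (a.2.contMDiff.continuous.smul continuous_const)⟩

/-- The adjoint action `Ad(u) = u 𝒥 u 𝒥⁻¹`. -/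
def adAction [CompactSpace M] [BorelSpace M] (u : TwistAlg m M) :
    L2Spinor S →L[ℂ] L2Spinor S :=
  let J : L2Spinor S →L⋆[ℂ] L2Spinor S :=
    (realStructure S).toContinuousLinearEquiv.toContinuousLinearMap
  let Jinv : L2Spinor S →L⋆[ℂ] L2Spinor S :=
    (realStructure S).symm.toContinuousLinearEquiv.toContinuousLinearMap
  (repAlg S u).comp (J.comp ((repAlg S u).comp Jinv))

/-- The composite `A D B` of an unbounded operator `D` with bounded operators `A` and `B`, on its
natural domain `{ψ | B ψ ∈ dom D}`. -/
def sandwich {H : Type*} [NormedAddCommGroup H] [NormedSpace ℂ H]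
    (A : H →L[ℂ] H) (D : H →ₗ.[ℂ] H) (B : H →L[ℂ] H) : H →ₗ.[ℂ] H where
  domain := D.domain.comap B.toLinearMap
  toFun := A.toLinearMap ∘ₗ D.toFun ∘ₗ
    (B.toLinearMap.restrict (p := D.domain.comap B.toLinearMap) fun _ hx => hx)

/-- The additional term `-i γ^μ η_μ γ` associated with a field of covectors `η`. -/
def torsionTerm (η : (x : M) → TangentSpace 𝓘(ℝ, Model m) x →L[ℝ] ℝ) :
    L2Spinor S →ₗ.[ℂ] L2Spinor S :=
  mulOp S fun x => (-Complex.I) • (S.cliff x (η x) * R.grading)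

/-- The `1`-form `d (ln |h|²)`. -/
def dLogNormSq (h : SmoothFun m M) (x : M) : TangentSpace 𝓘(ℝ, Model m) x →L[ℝ] ℝ :=
  mvfderiv 𝓘(ℝ, Model m) (fun y => Real.log (‖h y‖ ^ 2)) x

end Twist

/-! ### The Dirac operator on smooth spinors is well defined -/

section WellDefined
variable {m : ℕ} {M : Type*} [TopologicalSpace M] [ChartedSpace (Model m) M]
  [IsManifold 𝓘(ℝ, Model m) ∞ M]
  [RiemannianBundle (fun x : M => TangentSpace 𝓘(ℝ, Model m) x)]
  [IsContMDiffRiemannianBundle 𝓘(ℝ, Model m) ∞ (Model m)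
      (fun x : M => TangentSpace 𝓘(ℝ, Model m) x)]

theorem volumeDensity_pos {e : OpenPartialHomeomorph M (Model m)} (he : e ∈ atlas (Model m) M)
    {y : Model m} (hy : y ∈ e.target) : 0 < volumeDensity e y := by
  have hd := (mdifferentiable_of_mem_atlas (I := 𝓘(ℝ, Model m)) he).symm
  have hinj := hd.mfderiv_injective (x := y) hy
  refine Real.sqrt_pos.2 (Matrix.PosDef.det_pos
    (Matrix.posDef_gram_of_linearIndependent (𝕜 := ℝ) ?_))
  have hb : LinearIndependent ℝ
      (fun μ : Fin (2 * m) => (EuclideanSpace.single μ (1 : ℝ) : Model m)) := by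
    have := (EuclideanSpace.basisFun (Fin (2 * m)) ℝ).toBasis.linearIndependent
    have h2 : ⇑(EuclideanSpace.basisFun (Fin (2 * m)) ℝ).toBasis =
        fun μ : Fin (2 * m) => (EuclideanSpace.single μ (1 : ℝ) : Model m) := by
      ext1 μ
      simp
    rwa [h2] at this
  exact hb.map' (mfderiv 𝓘(ℝ, Model m) 𝓘(ℝ, Model m) e.symm y).toLinearMap
    (LinearMap.ker_eq_bot.2 hinj)

theorem continuousOn_volumeDensity {e : OpenPartialHomeomorph M (Model m)}
    (he : e ∈ atlas (Model m) M) : ContinuousOn (volumeDensity e) e.target := by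
  have hs : ContMDiffOn 𝓘(ℝ, Model m) 𝓘(ℝ, Model m) ∞ e.symm e.target :=
    contMDiffOn_symm_of_mem_maximalAtlas (IsManifold.subset_maximalAtlas he)
  have hc : ∀ μ : Fin (2 * m), ContinuousOn (fun y : Model m =>
      (⟨e.symm y, mfderiv 𝓘(ℝ, Model m) 𝓘(ℝ, Model m) e.symm y
        (EuclideanSpace.single μ (1 : ℝ) : Model m)⟩ : TangentBundle 𝓘(ℝ, Model m) M))
      e.target := by
    intro μ
    have h1 := hs.continuousOn_tangentMapWithin (by simp) e.open_target.uniqueMDiffOn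
    have h2 : Continuous (fun y : Model m =>
        (⟨y, (EuclideanSpace.single μ (1 : ℝ) : Model m)⟩ :
          TangentBundle 𝓘(ℝ, Model m) (Model m))) := by
      exact (tangentBundleModelSpaceHomeomorph 𝓘(ℝ, Model m)).symm.continuous.comp
        (continuous_id.prodMk continuous_const)
    refine (h1.comp h2.continuousOn (fun y hy => hy)).congr fun y hy => ?_
    simp only [Function.comp, tangentMapWithin]
    rw [mfderivWithin_of_isOpen e.open_target hy]
  have : IsContinuousRiemannianBundle (Model m)
      (fun x : M => TangentSpace 𝓘(ℝ, Model m) x) := by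
    obtain ⟨g, hg, hg'⟩ := IsContMDiffRiemannianBundle.exists_contMDiff (IB := 𝓘(ℝ, Model m))
      (n := ∞) (F := Model m) (E := fun x : M => TangentSpace 𝓘(ℝ, Model m) x)
    exact ⟨g, hg.continuous, hg'⟩
  refine Real.continuous_sqrt.comp_continuousOn ?_
  simp only [Matrix.det_apply, Matrix.of_apply]
  refine continuousOn_finsetSum _ fun σ _ =>
    ContinuousOn.const_smul (continuousOn_finsetProd _ fun i _ => ?_) _
  exact (hc (σ i)).inner_bundle (hc i)

theorem riemannianVolume_pos [MeasurableSpace M] [BorelSpace M] {V : Set M} (hV : IsOpen V)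
    (hne : V.Nonempty) : riemannianVolume m M V ≠ 0 := by
  obtain ⟨x, hx⟩ := hne
  set e := chartAt (Model m) x with he
  have hea : e ∈ atlas (Model m) M := chart_mem_atlas _ x
  intro h0
  have hle : ((volume.withDensity fun y => ENNReal.ofReal (volumeDensity e y)).restrict
      e.target).map e.symm ≤ riemannianVolume m M :=
    le_iSup₂_of_le (f := fun (e : OpenPartialHomeomorph M (Model m)) (_ : e ∈ atlas (Model m) M) =>
      ((volume.withDensity fun y => ENNReal.ofReal (volumeDensity e y)).restrict
        e.target).map e.symm) e hea le_rfl
  have h1 := le_antisymm ((hle V).trans h0.le) (zero_le)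
  have hmeas : AEMeasurable e.symm
      ((volume.withDensity fun y => ENNReal.ofReal (volumeDensity e y)).restrict e.target) :=
    e.continuousOn_symm.aemeasurable e.open_target.measurableSet
  rw [Measure.map_apply_of_aemeasurable hmeas hV.measurableSet,
    restrict_withDensity e.open_target.measurableSet] at h1
  have hρ : AEMeasurable (fun y => ENNReal.ofReal (volumeDensity e y))
      (volume.restrict e.target) :=
    ((continuousOn_volumeDensity hea).aemeasurable e.open_target.measurableSet).ennreal_ofReal
  rw [withDensity_apply_eq_zero' hρ] at h1
  have hO : IsOpen (e.target ∩ e.symm ⁻¹' V) := e.isOpen_inter_preimage_symm hV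
  have hOne : (e.target ∩ e.symm ⁻¹' V).Nonempty :=
    ⟨e x, e.map_source (mem_chart_source _ x), by
      simpa [he] using hx⟩
  refine (hO.measure_pos volume hOne).ne' (le_antisymm ?_ zero_le)
  rw [Measure.restrict_apply' e.open_target.measurableSet] at h1
  refine (measure_mono ?_).trans h1.le
  intro y hy
  exact ⟨⟨by simpa using volumeDensity_pos hea hy.1, hy.2⟩, hy.1⟩

theorem eq_zero_of_ae [MeasurableSpace M] [BorelSpace M] {R : DiracMatrices m}
    (S : SpinStructure R M) {ψ : M → Spinor m} (hψ : S.IsSmooth ψ)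
    (h0 : ψ =ᵐ[riemannianVolume m M] 0) : ψ = 0 := by
  by_contra hne
  obtain ⟨x, hx⟩ := Function.ne_iff.1 hne
  have hop : IsOpen (S.U (S.idx x) ∩ S.inFrame (S.idx x) ψ ⁻¹' {0}ᶜ) :=
    (hψ (S.idx x)).continuousOn.isOpen_inter_preimage (S.isOpen_U _) isOpen_compl_singleton
  refine riemannianVolume_pos hop ⟨x, S.mem_idx x, ?_⟩ (measure_mono_null ?_ h0)
  · simpa [SpinStructure.inFrame_idx] using hx
  · intro y hy hy0
    refine hy.2 ?_
    have : ψ y = 0 := hy0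
    simp [SpinStructure.inFrame, this]

/-- The graph of the Dirac operator on smooth spinors is the graph of a function. -/
theorem diracGraph_functional [MeasurableSpace M] [BorelSpace M] {R : DiracMatrices m}
    (S : SpinStructure R M) (cov : CovariantDerivative 𝓘(ℝ, Model m) (Model m)
      (fun x : M => TangentSpace 𝓘(ℝ, Model m) x)) :
    ∀ p ∈ diracGraph S cov, p.1 = 0 → p.2 = 0 := by
  rintro p ⟨ψ, hψ, h1, h2⟩ hp
  rw [hp] at h1
  have : ψ = 0 := eq_zero_of_ae S hψ (h1.symm.trans (Lp.coeFn_zero _ _ _))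
  rw [this, SpinStructure.diracSection_zero] at h2
  exact Lp.ext (h2.trans (Lp.coeFn_zero _ _ _).symm)

end WellDefined

end TwistedDirac

end

open TwistedDirac

/-!
In dimension `2m` with `m` even, the product of the Dirac matrices is a selfadjoint involution that
commutes with the charge conjugation `𝒥`, and the phase in front of it in the grading `γ` is a
sign; hence `γ` is a selfadjoint involution with `𝒥 γ = γ 𝒥` and `γᵃ γ = -γ γᵃ`. So
`𝒥 π(f, g) 𝒥⁻¹ = π(f̄, ḡ)`, and `Ad(u_h)` is multiplication by the selfadjoint field of matrices
`π(|h|², |h|⁻²) = e^{λγ}`, where `λ = ln |h|²` (`adAction_coeFn`, `adjoint_adAction`). Its inverse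
`e^{-λγ}` is `Ad(u_{1/h})`.

Multiplication by `e^{λγ}` commutes with the changes of frame and with the connection terms of the
spinor covariant derivative, all of which are even in the Dirac matrices, and
`γᵃ e^{λγ} = e^{-λγ} γᵃ`. The Leibniz rule therefore reads
`D (e^{λγ} φ) = e^{-λγ} (D φ - i γ^μ (∂_μ λ) γ φ)` for smooth `φ`
(`SpinStructure.diracSection_chiralExp`), which is the claim on smooth spinors. The domains agree
since `e^{λγ}` permutes the smooth spinors and the additional term is a bounded operator: the
components of `dλ` in the chosen frames, which jump where the frame changes, are
measurable, and bounded by compactness of `M` (`SpinStructure.exists_abs_mvfderiv_frame_le`).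

The claim on the closures follows because composing with invertible bounded operators and adding
an everywhere defined bounded operator act on graphs through homeomorphisms of `H × H`, and so
commute with closures (`sandwich_closure`, `add_toPMap_closure`).
-/

namespace TwistedDirac

/-! ### Products of anticommuting involutions -/

section Anticommuting

variable {ι A : Type*} [Ring A] {g : ι → A}

theorem mul_prod_of_notMem (hg : ∀ a b, a ≠ b → g a * g b = -(g b * g a)) {a : ι} {l : List ι}
    (ha : a ∉ l) : g a * (l.map g).prod = (-1) ^ l.length * ((l.map g).prod * g a) := by
  induction l with
  | nil => simp
  | cons b l ih =>
    rw [List.mem_cons, not_or] at ha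
    rw [List.map_cons, List.prod_cons, ← mul_assoc, hg a b ha.1, neg_mul, mul_assoc, ih ha.2,
      ← mul_assoc, ← ((Commute.neg_one_left (g b)).pow_left _).eq, List.length_cons, pow_succ']
    simp [mul_assoc]

theorem mul_prod_of_mem (hg : ∀ a b, a ≠ b → g a * g b = -(g b * g a)) {a : ι} {l : List ι}
    (hl : l.Nodup) (ha : a ∈ l) :
    g a * (l.map g).prod = -((-1) ^ l.length * ((l.map g).prod * g a)) := by
  induction l with
  | nil => simp at ha
  | cons b l ih =>
    rw [List.nodup_cons] at hl
    by_cases hab : a = b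
    · subst hab
      rw [List.map_cons, List.prod_cons, mul_assoc (g a) (l.map g).prod, List.length_cons, pow_succ',
        mul_assoc (-1), ← mul_assoc (_ ^ _) (g a), ((Commute.neg_one_left (g a)).pow_left _).eq,
        mul_assoc (g a), ← mul_prod_of_notMem hg hl.1]
      simp
    · have hal : a ∈ l := (List.mem_cons.1 ha).resolve_left hab
      rw [List.map_cons, List.prod_cons, ← mul_assoc, hg a b hab, neg_mul,
        mul_assoc, ih hl.2 hal, mul_neg, ← mul_assoc,
        ← ((Commute.neg_one_left (g b)).pow_left _).eq, List.length_cons, pow_succ']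
      simp [mul_assoc]

theorem star_prod_map [StarRing A] (hs : ∀ a, star (g a) = g a) (l : List ι) :
    star (l.map g).prod = (l.reverse.map g).prod := by
  induction l with
  | nil => simp
  | cons b l ih =>
    rw [List.map_cons, List.prod_cons, star_mul, ih, hs]
    simp

theorem prod_mul_prod_reverse (hg : ∀ a, g a * g a = 1) (l : List ι) :
    (l.map g).prod * (l.reverse.map g).prod = 1 := by
  induction l with
  | nil => simp
  | cons b l ih =>
    have h : ((b :: l).reverse.map g).prod = (l.reverse.map g).prod * g b := by simp
    rw [h, List.map_cons, List.prod_cons, mul_assoc, ← mul_assoc (l.map g).prod, ih, one_mul, hg]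

theorem prod_reverse (hg : ∀ a b, a ≠ b → g a * g b = -(g b * g a)) {l : List ι} (hl : l.Nodup) :
    (l.reverse.map g).prod = (-1) ^ l.length.choose 2 * (l.map g).prod := by
  induction l with
  | nil => simp
  | cons b l ih =>
    rw [List.nodup_cons] at hl
    have h : ((b :: l).reverse.map g).prod = (l.reverse.map g).prod * g b := by simp
    have h2 : (l.map g).prod * g b = (-1) ^ l.length * (g b * (l.map g).prod) := by
      rw [mul_prod_of_notMem hg hl.1, ← mul_assoc, ← pow_add, ← two_mul, pow_mul]
      simp
    rw [h, ih hl.2, mul_assoc, h2, ← mul_assoc, ← pow_add, List.length_cons, Nat.choose_succ_succ',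
      Nat.choose_one_right, add_comm, List.map_cons, List.prod_cons]

variable {m : ℕ} {g : Fin (2 * m) → A}

theorem mul_prod_ofFn (hg : ∀ a b, a ≠ b → g a * g b = -(g b * g a)) (a : Fin (2 * m)) :
    g a * (List.ofFn g).prod = -((List.ofFn g).prod * g a) := by
  rw [List.ofFn_eq_map, mul_prod_of_mem hg (List.nodup_finRange _) (List.mem_finRange a),
    List.length_finRange, pow_mul]
  simp

/-- Reversing a product of `2m` anticommuting factors costs the sign `(-1)^(m(2m-1))`, which is `1`
for even `m`. -/
theorem prod_reverse_finRange (hg : ∀ a b, a ≠ b → g a * g b = -(g b * g a)) (hm : Even m) :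
    ((List.finRange (2 * m)).reverse.map g).prod = (List.ofFn g).prod := by
  have h : (2 * m).choose 2 = m * (2 * m - 1) := by
    rw [Nat.choose_two_right, mul_assoc, Nat.mul_div_cancel_left _ two_pos]
  rw [prod_reverse hg (List.nodup_finRange _), List.length_finRange, h, pow_mul, hm.neg_one_pow,
    one_pow, one_mul, List.ofFn_eq_map]

theorem prod_ofFn_mul_self (hg : ∀ a b, a ≠ b → g a * g b = -(g b * g a))
    (hg1 : ∀ a, g a * g a = 1) (hm : Even m) : (List.ofFn g).prod * (List.ofFn g).prod = 1 := by
  have h := prod_mul_prod_reverse hg1 (List.finRange (2 * m))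
  rwa [prod_reverse_finRange hg hm, ← List.ofFn_eq_map] at h

theorem star_prod_ofFn [StarRing A] (hg : ∀ a b, a ≠ b → g a * g b = -(g b * g a))
    (hs : ∀ a, star (g a) = g a) (hm : Even m) : star (List.ofFn g).prod = (List.ofFn g).prod := by
  conv_lhs => rw [List.ofFn_eq_map, star_prod_map hs, prod_reverse_finRange hg hm]

theorem commute_mul_of_anticommute {x y e : A} (hx : x * e = -(e * x)) (hy : y * e = -(e * y)) :
    Commute (x * y) e := by
  rw [Commute, SemiconjBy, mul_assoc, hy, mul_neg, ← mul_assoc, hx, neg_mul, neg_neg, mul_assoc]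

end Anticommuting

/-! ### Functions of an involution -/

section Involution

variable {A : Type*} [Ring A] [Algebra ℂ A]

/-- The element `f (1 + e)/2 + g (1 - e)/2`, for an involution `e` of an algebra. -/
noncomputable def ofInvolution (e : A) (f g : ℂ) : A :=
  f • ((2⁻¹ : ℂ) • (1 + e)) + g • ((2⁻¹ : ℂ) • (1 - e))

theorem ofInvolution_eq (e : A) (f g : ℂ) :
    ofInvolution e f g = ((f + g) / 2) • (1 : A) + ((f - g) / 2) • e := by
  rw [ofInvolution]
  module

theorem ofInvolution_one_one (e : A) : ofInvolution e 1 1 = 1 := by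
  rw [ofInvolution_eq]
  norm_num

variable {e : A}

theorem ofInvolution_mul (he : e * e = 1) (f g f' g' : ℂ) :
    ofInvolution e f g * ofInvolution e f' g' = ofInvolution e (f * f') (g * g') := by
  simp only [ofInvolution_eq, add_mul, mul_add, smul_mul_smul_comm, he, one_mul, mul_one]
  module

theorem mul_ofInvolution (he : e * e = 1) (f g : ℂ) :
    e * ofInvolution e f g = ofInvolution e f (-g) := by
  have h : e = ofInvolution e 1 (-1) := by
    rw [ofInvolution_eq]
    norm_num
  calc e * ofInvolution e f g = ofInvolution e 1 (-1) * ofInvolution e f g := by rw [← h]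
    _ = ofInvolution e f (-g) := by rw [ofInvolution_mul he, one_mul, neg_one_mul]

theorem mul_ofInvolution_of_anticommute {x : A} (hx : x * e = -(e * x)) (f g : ℂ) :
    x * ofInvolution e f g = ofInvolution e g f * x := by
  simp only [ofInvolution_eq, add_mul, mul_add, smul_mul_assoc, mul_smul_comm, hx, one_mul, mul_one]
  module

theorem commute_ofInvolution {x : A} (hx : Commute x e) (f g : ℂ) :
    Commute x (ofInvolution e f g) := by
  rw [ofInvolution_eq]
  exact ((Commute.one_right _).smul_right _).add_right (hx.smul_right _)

theorem star_ofInvolution [StarRing A] [StarModule ℂ A] (he : star e = e) (f g : ℂ) :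
    star (ofInvolution e f g) = ofInvolution e (star f) (star g) := by
  simp [ofInvolution_eq, he]

end Involution

/-! ### The grading and the charge conjugation -/

namespace DiracMatrices

variable {m : ℕ} (R : DiracMatrices m)

theorem gamma_mul_self (a : Fin (2 * m)) : R.gamma a * R.gamma a = 1 := by
  have h := R.gamma_anticomm a a
  rw [if_pos rfl, ← two_smul ℂ] at h
  exact smul_right_injective _ (two_ne_zero (α := ℂ)) h

theorem gamma_mul_gamma_of_ne (a b : Fin (2 * m)) (hab : a ≠ b) :
    R.gamma a * R.gamma b = -(R.gamma b * R.gamma a) := by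
  have h := R.gamma_anticomm a b
  rw [if_neg hab] at h
  exact eq_neg_of_add_eq_zero_left (h.trans (zero_smul ℂ (1 : Spinor m →L[ℂ] Spinor m)))

theorem chargeConj_prod (l : List (Fin (2 * m))) (v : Spinor m) :
    R.chargeConj ((l.map R.gamma).prod v) =
      (-1 : ℂ) ^ l.length • (l.map R.gamma).prod (R.chargeConj v) := by
  induction l generalizing v with
  | nil => simp
  | cons b l ih =>
    rw [List.map_cons, List.prod_cons]
    change R.chargeConj (R.gamma b ((l.map R.gamma).prod v)) =
      _ • R.gamma b ((l.map R.gamma).prod (R.chargeConj v))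
    rw [R.chargeConj_gamma, ih, map_smul, List.length_cons, pow_succ', mul_smul, neg_one_smul]

theorem chargeConj_prod_ofFn (v : Spinor m) :
    R.chargeConj ((List.ofFn R.gamma).prod v) = (List.ofFn R.gamma).prod (R.chargeConj v) := by
  rw [List.ofFn_eq_map, R.chargeConj_prod, List.length_finRange, pow_mul]
  norm_num

variable {R}

/-- For even `m` the phase `± (-i)^m` in the grading is a sign. -/
theorem exists_grading_eq (hm : Even m) : ∃ ε : ℂ, star ε = ε ∧ ε * ε = 1 ∧
    R.grading = ε • (List.ofFn R.gamma).prod := by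
  have h1 : star ((-Complex.I) ^ m) = (-Complex.I) ^ m := by
    rw [star_pow, star_neg, Complex.star_def, Complex.conj_I, neg_neg, hm.neg_pow]
  have h2 : (-Complex.I) ^ m * (-Complex.I) ^ m = 1 := by
    rw [← mul_pow, neg_mul_neg, Complex.I_mul_I, hm.neg_one_pow]
  rcases R.grading_eq with h | h
  · exact ⟨-(-Complex.I) ^ m, by rw [star_neg, h1], by rw [neg_mul_neg, h2],
      h.trans (neg_smul ((-Complex.I) ^ m) (List.ofFn R.gamma).prod).symm⟩
  · exact ⟨(-Complex.I) ^ m, h1, h2, h⟩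

theorem gamma_mul_grading (hm : Even m) (a : Fin (2 * m)) :
    R.gamma a * R.grading = -(R.grading * R.gamma a) := by
  obtain ⟨ε, -, -, h⟩ := exists_grading_eq (R := R) hm
  rw [h, mul_smul_comm, smul_mul_assoc, mul_prod_ofFn R.gamma_mul_gamma_of_ne]
  exact smul_neg _ _

theorem grading_mul_self (hm : Even m) : R.grading * R.grading = 1 := by
  obtain ⟨ε, -, h1, h⟩ := exists_grading_eq (R := R) hm
  rw [h, smul_mul_smul_comm, h1, one_smul,
    prod_ofFn_mul_self R.gamma_mul_gamma_of_ne R.gamma_mul_self hm]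

theorem star_grading (hm : Even m) : star R.grading = R.grading := by
  obtain ⟨ε, h1, -, h⟩ := exists_grading_eq (R := R) hm
  rw [h, star_smul, h1, star_prod_ofFn R.gamma_mul_gamma_of_ne
    (fun a => (R.gamma_selfAdjoint a).star_eq) hm]

theorem chargeConj_grading (hm : Even m) (v : Spinor m) :
    R.chargeConj (R.grading v) = R.grading (R.chargeConj v) := by
  obtain ⟨ε, h1, -, h⟩ := exists_grading_eq (R := R) hm
  rw [h, smul_apply, smul_apply, R.chargeConj.map_smulₛₗ, chargeConj_prod_ofFn]
  exact congrArg (· • _) h1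

variable (R)

/-- The matrix `f (1 + γ)/2 + g (1 - γ)/2`. -/
noncomputable def chiral (f g : ℂ) : Spinor m →L[ℂ] Spinor m := f • R.projPos + g • R.projNeg

theorem chiral_one_one : R.chiral 1 1 = 1 := ofInvolution_one_one R.grading

variable {R}

theorem chiral_mul_chiral (hm : Even m) (f g f' g' : ℂ) :
    R.chiral f g * R.chiral f' g' = R.chiral (f * f') (g * g') :=
  ofInvolution_mul (grading_mul_self hm) f g f' g'

theorem chiral_chiral_apply (hm : Even m) (f g f' g' : ℂ) (v : Spinor m) :
    R.chiral f g (R.chiral f' g' v) = R.chiral (f * f') (g * g') v := by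
  rw [← chiral_mul_chiral hm]
  rfl

theorem grading_mul_chiral (hm : Even m) (f g : ℂ) :
    R.grading * R.chiral f g = R.chiral f (-g) :=
  mul_ofInvolution (grading_mul_self hm) f g

theorem gamma_mul_chiral (hm : Even m) (a : Fin (2 * m)) (f g : ℂ) :
    R.gamma a * R.chiral f g = R.chiral g f * R.gamma a :=
  mul_ofInvolution_of_anticommute (gamma_mul_grading hm a) f g

theorem star_chiral (hm : Even m) (f g : ℂ) : star (R.chiral f g) = R.chiral (star f) (star g) :=
  star_ofInvolution (star_grading hm) f g

theorem chargeConj_chiral (hm : Even m) (f g : ℂ) (v : Spinor m) :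
    R.chargeConj (R.chiral f g v) = R.chiral (star f) (star g) (R.chargeConj v) := by
  have h (f g : ℂ) (v : Spinor m) :
      R.chiral f g v = ((f + g) / 2) • v + ((f - g) / 2) • R.grading v :=
    congrArg (· v) (ofInvolution_eq R.grading f g)
  rw [h, h, map_add, R.chargeConj.map_smulₛₗ, R.chargeConj.map_smulₛₗ, chargeConj_grading hm]
  simp [Complex.conj_ofNat]

theorem vec_mul_grading (hm : Even m) (v : Fin (2 * m) → ℝ) :
    R.vec v * R.grading = -(R.grading * R.vec v) := by
  refine Eq.trans ?_ (Finset.sum_neg_distrib _) |>.trans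
    (congrArg Neg.neg (Finset.mul_sum _ _ R.grading).symm)
  refine (Finset.sum_mul _ _ R.grading).trans (Finset.sum_congr rfl fun a _ => ?_)
  rw [smul_mul_assoc, mul_smul_comm, gamma_mul_grading hm]
  exact smul_neg _ _

theorem commute_rep_grading (hm : Even m) {x : CliffordAlgebra (euclideanForm m)}
    (hx : x ∈ CliffordAlgebra.even (euclideanForm m)) : Commute (R.rep x) R.grading := by
  have hι : ∀ v, R.rep (CliffordAlgebra.ι _ v) = R.vec v := fun v => by simp [rep]
  refine CliffordAlgebra.even_induction (Q := euclideanForm m)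
    (motive := fun x _ => Commute (R.rep x) R.grading) ?_ ?_ ?_ x hx
  · intro r
    rw [AlgHom.commutes]
    exact Algebra.commutes r _
  · intro x y _ _ h1 h2
    rw [map_add]
    exact h1.add_left h2
  · intro v w x _ h
    rw [map_mul, map_mul, hι, hι]
    refine Commute.mul_left ?_ h
    exact commute_mul_of_anticommute (vec_mul_grading hm v) (vec_mul_grading hm w)

/-- The spin representation is of even degree, so it commutes with the grading. -/
theorem commute_rep_chiral (hm : Even m) {x : CliffordAlgebra (euclideanForm m)}
    (hx : x ∈ CliffordAlgebra.even (euclideanForm m)) (f g : ℂ) :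
    Commute (R.rep x) (R.chiral f g) :=
  commute_ofInvolution (commute_rep_grading hm hx) f g

end DiracMatrices

/-! ### Closures of unbounded operators -/

section Closure

variable {H : Type*} [NormedAddCommGroup H] [NormedSpace ℂ H]

/-- An operation on unbounded operators that acts on graphs through a homeomorphism `E` of `H × H`,
and is inverted by an operation of the same kind, commutes with closures. The operation `Ψ` that
inverts it is needed since the closure of an operator that is not closable is the operator
itself. -/
theorem closure_comm_of_graph_map (E : (H × H) ≃L[ℂ] (H × H)) {Φ Ψ : (H →ₗ.[ℂ] H) → (H →ₗ.[ℂ] H)}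
    (hΦ : ∀ D, (Φ D).graph = D.graph.map (E : (H × H) →ₗ[ℂ] (H × H)))
    (hΨ : ∀ D, (Ψ D).graph = D.graph.map (E.symm : (H × H) →ₗ[ℂ] (H × H)))
    (D : H →ₗ.[ℂ] H) : (Φ D).closure = Φ D.closure := by
  have key : ∀ (E : (H × H) ≃L[ℂ] (H × H)) (Φ : (H →ₗ.[ℂ] H) → (H →ₗ.[ℂ] H)),
      (∀ D, (Φ D).graph = D.graph.map (E : (H × H) →ₗ[ℂ] (H × H))) →
      ∀ D : H →ₗ.[ℂ] H, D.IsClosable → (Φ D).graph.topologicalClosure = (Φ D.closure).graph := by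
    intro E Φ hΦ D hD
    rw [hΦ, hΦ, ← hD.graph_closure_eq_closure_graph]
    refine SetLike.coe_injective ?_
    exact (E.image_closure _).symm
  -- An operator that is not closable is its own closure, by convention.
  by_cases hD : D.IsClosable
  · have h := key E Φ hΦ D hD
    refine LinearPMap.eq_of_eq_graph ?_
    rw [← h, LinearPMap.IsClosable.graph_closure_eq_closure_graph ⟨_, h⟩]
  · have hΨΦ : Ψ (Φ D) = D := by
      refine LinearPMap.eq_of_eq_graph ?_
      rw [hΨ, hΦ, ← Submodule.map_comp]
      have h : (E.symm : (H × H) →ₗ[ℂ] (H × H)) ∘ₗ (E : (H × H) →ₗ[ℂ] (H × H)) = LinearMap.id :=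
        LinearMap.ext E.symm_apply_apply
      rw [h, Submodule.map_id]
    have hΦD : ¬(Φ D).IsClosable := fun h => hD <| by
      have h2 := key E.symm Ψ hΨ (Φ D) h
      rw [hΨΦ] at h2
      exact ⟨_, h2⟩
    rw [LinearPMap.closure_def' hΦD, LinearPMap.closure_def' hD]

theorem sandwich_graph (A B : H ≃L[ℂ] H) (D : H →ₗ.[ℂ] H) :
    (sandwich (A : H →L[ℂ] H) D (B : H →L[ℂ] H)).graph =
      D.graph.map ((B.symm.prodCongr A : (H × H) ≃L[ℂ] (H × H)) : (H × H) →ₗ[ℂ] (H × H)) := by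
  ext ⟨x, y⟩
  simp only [LinearPMap.mem_graph_iff, Submodule.mem_map, Prod.exists, Subtype.exists]
  constructor
  · rintro ⟨z, hz, rfl, rfl⟩
    exact ⟨B z, D ⟨B z, hz⟩, ⟨B z, hz, rfl, rfl⟩, by
      simp; rfl⟩
  · rintro ⟨_, _, ⟨z, hz, rfl, rfl⟩, h⟩
    obtain ⟨rfl, rfl⟩ := Prod.mk.inj h
    have hz' : B (B.symm z) ∈ D.domain := by rwa [B.apply_symm_apply]
    refine ⟨B.symm z, hz', rfl, ?_⟩
    change A (D ⟨B (B.symm z), _⟩) = A (D ⟨z, hz⟩)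
    simp

theorem sandwich_closure (A B : H ≃L[ℂ] H) (D : H →ₗ.[ℂ] H) :
    (sandwich (A : H →L[ℂ] H) D (B : H →L[ℂ] H)).closure =
      sandwich (A : H →L[ℂ] H) D.closure (B : H →L[ℂ] H) :=
  closure_comm_of_graph_map (B.symm.prodCongr A) (sandwich_graph A B)
    (sandwich_graph A.symm B.symm) D

theorem add_toPMap_graph (T : H →L[ℂ] H) (D : H →ₗ.[ℂ] H) :
    (D + (T : H →ₗ[ℂ] H).toPMap ⊤).graph = D.graph.map
      (((ContinuousLinearEquiv.refl ℂ H).skewProd (ContinuousLinearEquiv.refl ℂ H) T :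
        (H × H) ≃L[ℂ] (H × H)) : (H × H) →ₗ[ℂ] (H × H)) := by
  ext ⟨x, y⟩
  simp only [LinearPMap.mem_graph_iff, Submodule.mem_map, Prod.exists, Subtype.exists]
  constructor
  · rintro ⟨z, hz, rfl, rfl⟩
    exact ⟨z, D ⟨z, hz.1⟩, ⟨z, hz.1, rfl, rfl⟩, rfl⟩
  · rintro ⟨_, _, ⟨z, hz, rfl, rfl⟩, h⟩
    obtain ⟨rfl, rfl⟩ := Prod.mk.inj h
    exact ⟨z, ⟨hz, trivial⟩, rfl, rfl⟩

theorem add_toPMap_closure (T : H →L[ℂ] H) (D : H →ₗ.[ℂ] H) :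
    (D + (T : H →ₗ[ℂ] H).toPMap ⊤).closure = D.closure + (T : H →ₗ[ℂ] H).toPMap ⊤ := by
  refine closure_comm_of_graph_map _ (Ψ := fun D => D + ((-T : H →L[ℂ] H) : H →ₗ[ℂ] H).toPMap ⊤)
    (add_toPMap_graph T) (fun D => ?_) D
  rw [add_toPMap_graph]
  refine congrArg (fun F => D.graph.map F) (LinearMap.ext fun p => Prod.ext rfl ?_)
  exact (sub_eq_add_neg p.2 (T p.1)).symm

end Closure

/-! ### The field of matrices `exp (λ γ)` -/

namespace DiracMatrices

variable {m : ℕ} (R : DiracMatrices m)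

/-- The matrix `exp (l γ) = eˡ (1 + γ)/2 + e⁻ˡ (1 - γ)/2`. -/
noncomputable def chiralExp (l : ℝ) : Spinor m →L[ℂ] Spinor m :=
  R.chiral (Real.exp l : ℝ) (Real.exp (-l) : ℝ)

theorem chiralExp_apply (l : ℝ) (v : Spinor m) : R.chiralExp l v =
    ((Real.exp l : ℝ) : ℂ) • R.projPos v + ((Real.exp (-l) : ℝ) : ℂ) • R.projNeg v := rfl

theorem contDiff_chiralExp_apply :
    ContDiff ℝ ∞ (fun p : ℝ × Spinor m => R.chiralExp p.1 p.2) := by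
  have hP : ContDiff ℝ ∞ (fun p : ℝ × Spinor m => R.projPos p.2) :=
    (R.projPos.restrictScalars ℝ).contDiff.comp contDiff_snd
  have hN : ContDiff ℝ ∞ (fun p : ℝ × Spinor m => R.projNeg p.2) :=
    (R.projNeg.restrictScalars ℝ).contDiff.comp contDiff_snd
  have h1 : ContDiff ℝ ∞ (fun p : ℝ × Spinor m => ((Real.exp p.1 : ℝ) : ℂ)) :=
    Complex.ofRealCLM.contDiff.comp (Real.contDiff_exp.comp contDiff_fst)
  have h2 : ContDiff ℝ ∞ (fun p : ℝ × Spinor m => ((Real.exp (-p.1) : ℝ) : ℂ)) :=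
    Complex.ofRealCLM.contDiff.comp (Real.contDiff_exp.comp contDiff_fst.neg)
  exact (h1.smul hP).add (h2.smul hN)

variable {R}

theorem chiralExp_neg_mul (hm : Even m) (l : ℝ) : R.chiralExp (-l) * R.chiralExp l = 1 := by
  rw [chiralExp, chiralExp, chiral_mul_chiral hm, neg_neg, ← Complex.ofReal_mul,
    ← Complex.ofReal_mul, ← Real.exp_add, ← Real.exp_add]
  simp [chiral_one_one]

theorem chiralExp_neg_apply (hm : Even m) (l : ℝ) (v : Spinor m) :
    R.chiralExp (-l) (R.chiralExp l v) = v := by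
  change (R.chiralExp (-l) * R.chiralExp l) v = v
  rw [chiralExp_neg_mul hm]
  rfl

theorem chiralExp_apply_neg (hm : Even m) (l : ℝ) (v : Spinor m) :
    R.chiralExp l (R.chiralExp (-l) v) = v := by
  simpa using chiralExp_neg_apply hm (-l) v

theorem inner_chiralExp (hm : Even m) (l : ℝ) (v w : Spinor m) :
    inner ℂ (R.chiralExp l v) w = inner ℂ v (R.chiralExp l w) := by
  have h : star (R.chiralExp l) = R.chiralExp l := by
    rw [chiralExp, star_chiral hm, Complex.star_def, Complex.conj_ofReal, Complex.conj_ofReal]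
  rw [ContinuousLinearMap.star_eq_adjoint] at h
  conv_lhs => rw [← h]
  exact ContinuousLinearMap.adjoint_inner_left _ _ _

theorem gamma_chiralExp (hm : Even m) (a : Fin (2 * m)) (l : ℝ) (v : Spinor m) :
    R.gamma a (R.chiralExp l v) = R.chiralExp (-l) (R.gamma a v) := by
  have h : R.gamma a * R.chiralExp l = R.chiralExp (-l) * R.gamma a := by
    rw [chiralExp, gamma_mul_chiral hm, chiralExp, neg_neg]
  exact congrArg (· v) h

theorem grading_chiralExp (l : ℝ) (v : Spinor m) :
    R.grading (R.chiralExp l v) = R.chiralExp l (R.grading v) :=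
  congrArg (· v) (commute_ofInvolution (Commute.refl R.grading) _ _).eq

theorem grading_chiralExp_apply (hm : Even m) (l : ℝ) (v : Spinor m) :
    R.grading (R.chiralExp l v) =
      ((Real.exp l : ℝ) : ℂ) • R.projPos v - ((Real.exp (-l) : ℝ) : ℂ) • R.projNeg v := by
  have h := congrArg (· v) (grading_mul_chiral (R := R) hm (Real.exp l : ℝ) (Real.exp (-l) : ℝ))
  refine h.trans ?_
  change ((Real.exp l : ℝ) : ℂ) • R.projPos v + (-((Real.exp (-l) : ℝ) : ℂ)) • R.projNeg v = _
  rw [neg_smul, sub_eq_add_neg]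

/-- The differential of `(l, v) ↦ exp (l γ) v`. -/
theorem fderiv_chiralExp_apply (hm : Even m) (p q : ℝ × Spinor m) :
    fderiv ℝ (fun p : ℝ × Spinor m => R.chiralExp p.1 p.2) p q =
      R.chiralExp p.1 q.2 + ((q.1 : ℝ) : ℂ) • R.grading (R.chiralExp p.1 p.2) := by
  have hP : HasFDerivAt (fun p : ℝ × Spinor m => R.projPos p.2) _ p :=
    (R.projPos.restrictScalars ℝ).hasFDerivAt.comp p hasFDerivAt_snd
  have hN : HasFDerivAt (fun p : ℝ × Spinor m => R.projNeg p.2) _ p :=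
    (R.projNeg.restrictScalars ℝ).hasFDerivAt.comp p hasFDerivAt_snd
  have h1 : HasFDerivAt (fun p : ℝ × Spinor m => ((Real.exp p.1 : ℝ) : ℂ)) _ p :=
    Complex.ofRealCLM.hasFDerivAt.comp p (hasFDerivAt_fst.exp)
  have h2 : HasFDerivAt (fun p : ℝ × Spinor m => ((Real.exp (-p.1) : ℝ) : ℂ)) _ p :=
    Complex.ofRealCLM.hasFDerivAt.comp p (hasFDerivAt_fst.neg.exp)
  have h := ((h1.smul hP).add (h2.smul hN)).fderiv
  have h' : (fun p : ℝ × Spinor m => R.chiralExp p.1 p.2) =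
      (fun p : ℝ × Spinor m => ((Real.exp p.1 : ℝ) : ℂ) • R.projPos p.2) +
        fun p => ((Real.exp (-p.1) : ℝ) : ℂ) • R.projNeg p.2 := rfl
  rw [h']
  erw [h]
  rw [grading_chiralExp_apply hm, chiralExp_apply]
  simp
  module

end DiracMatrices

/-! ### Spinors multiplied by `exp (λ γ)` -/

section Spinors

variable {m : ℕ} {R : DiracMatrices m} {M : Type*} [TopologicalSpace M] [ChartedSpace (Model m) M]
  [IsManifold 𝓘(ℝ, Model m) ∞ M]
  [RiemannianBundle (fun x : M => TangentSpace 𝓘(ℝ, Model m) x)]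

namespace SpinStructure

variable {S : SpinStructure R M}

theorem inFrame_chiralExp (hm : Even m) (l : M → ℝ) (ψ : M → Spinor m) {i : Fin S.k} {x : M}
    (hx : x ∈ S.U i) : S.inFrame i (fun y => R.chiralExp (l y) (ψ y)) x =
      R.chiralExp (l x) (S.inFrame i ψ x) :=
  congrArg (· (ψ x)) (DiracMatrices.commute_rep_chiral hm
    (spinGroup.mem_even (S.lift_mem i (S.idx x) x ⟨hx, S.mem_idx x⟩)) _ _).eq

theorem IsSmooth.chiralExp (hm : Even m) {l : M → ℝ}
    (hl : ContMDiff 𝓘(ℝ, Model m) 𝓘(ℝ, ℝ) ∞ l) {ψ : M → Spinor m} (hψ : S.IsSmooth ψ) :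
    S.IsSmooth (fun y => R.chiralExp (l y) (ψ y)) := fun i =>
  (R.contDiff_chiralExp_apply.contMDiff.comp_contMDiffOn
    (hl.contMDiffOn.prodMk_space (hψ i))).congr fun _ hx => inFrame_chiralExp hm l ψ hx

theorem mvfderiv_inFrame_chiralExp (hm : Even m) {l : M → ℝ}
    (hl : ContMDiff 𝓘(ℝ, Model m) 𝓘(ℝ, ℝ) ∞ l) {ψ : M → Spinor m} (hψ : S.IsSmooth ψ)
    {i : Fin S.k} {x : M} (hx : x ∈ S.U i) (v : TangentSpace 𝓘(ℝ, Model m) x) :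
    mvfderiv 𝓘(ℝ, Model m) (S.inFrame i (fun y => R.chiralExp (l y) (ψ y))) x v =
      R.chiralExp (l x) (mvfderiv 𝓘(ℝ, Model m) (S.inFrame i ψ) x v) +
        ((mvfderiv 𝓘(ℝ, Model m) l x v : ℝ) : ℂ) •
          R.grading (R.chiralExp (l x) (S.inFrame i ψ x)) := by
  have h0 : S.inFrame i (fun y => R.chiralExp (l y) (ψ y)) =ᶠ[nhds x]
      (fun p : ℝ × Spinor m => R.chiralExp p.1 p.2) ∘ fun y => (l y, S.inFrame i ψ y) := by
    filter_upwards [(S.isOpen_U i).mem_nhds hx] with y hy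
    exact inFrame_chiralExp hm l ψ hy
  have h1 : HasMFDerivAt 𝓘(ℝ, Model m) 𝓘(ℝ, ℝ × Spinor m) (fun y => (l y, S.inFrame i ψ y)) x
      ((mvfderiv 𝓘(ℝ, Model m) l x).prod (mvfderiv 𝓘(ℝ, Model m) (S.inFrame i ψ) x)) :=
    have h1 := (hl.mdifferentiable (by simp) x).hasMFDerivAt
    have h2 := (hψ.mdifferentiableAt hx).hasMFDerivAt
    ⟨h1.1.prodMk h2.1, h1.2.prodMk h2.2⟩
  have h2 := (R.contDiff_chiralExp_apply.differentiable (by simp)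
    (l x, S.inFrame i ψ x)).hasFDerivAt.hasMFDerivAt
  have h3 := (h2.comp x h1).mfderiv
  change mfderiv 𝓘(ℝ, Model m) 𝓘(ℝ, Spinor m) _ x v = _
  rw [h0.mfderiv_eq]
  erw [h3]
  exact DiracMatrices.fderiv_chiralExp_apply hm _ _

variable (cov : CovariantDerivative 𝓘(ℝ, Model m) (Model m)
  (fun x : M => TangentSpace 𝓘(ℝ, Model m) x))

/-- The connection terms `γᵇ γᶜ` are even, so only the derivative of `l` contributes beyond
`e^{lγ} ∇ ψ`. -/
theorem spinCov_chiralExp (hm : Even m) {l : M → ℝ}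
    (hl : ContMDiff 𝓘(ℝ, Model m) 𝓘(ℝ, ℝ) ∞ l) {ψ : M → Spinor m} (hψ : S.IsSmooth ψ)
    (x : M) (v : TangentSpace 𝓘(ℝ, Model m) x) :
    S.spinCov cov (fun y => R.chiralExp (l y) (ψ y)) x v =
      R.chiralExp (l x) (S.spinCov cov ψ x v) +
        ((mvfderiv 𝓘(ℝ, Model m) l x v : ℝ) : ℂ) • R.grading (R.chiralExp (l x) (ψ x)) := by
  rw [spinCov, spinCov, mvfderiv_inFrame_chiralExp hm hl hψ (S.mem_idx x), inFrame_idx, map_add,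
    map_smul, map_sum]
  simp only [map_sum, map_smul, DiracMatrices.gamma_chiralExp hm, neg_neg]
  abel

/-- The Leibniz rule `D (e^{λγ} ψ) = e^{-λγ} (D ψ - i γ^μ (∂_μ λ) γ ψ)`. -/
theorem diracSection_chiralExp (hm : Even m) {l : M → ℝ}
    (hl : ContMDiff 𝓘(ℝ, Model m) 𝓘(ℝ, ℝ) ∞ l) {ψ : M → Spinor m} (hψ : S.IsSmooth ψ) (x : M) :
    S.diracSection cov (fun y => R.chiralExp (l y) (ψ y)) x =
      R.chiralExp (-l x) (S.diracSection cov ψ x +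
        ((-Complex.I) • (S.cliff x (mvfderiv 𝓘(ℝ, Model m) l x) * R.grading)) (ψ x)) := by
  have hc : ((-Complex.I) • (S.cliff x (mvfderiv 𝓘(ℝ, Model m) l x) * R.grading)) (ψ x) =
      (-Complex.I) • ∑ a, ((mvfderiv 𝓘(ℝ, Model m) l x (S.frame (S.idx x) a x) : ℝ) : ℂ) •
        R.gamma a (R.grading (ψ x)) := by
    change (-Complex.I) • (S.cliff x (mvfderiv 𝓘(ℝ, Model m) l x)) (R.grading (ψ x)) = _
    rw [cliff, sum_apply]
    rfl
  rw [hc, diracSection, diracSection, ← smul_add, map_smul, ← Finset.sum_add_distrib, map_sum]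
  refine congrArg _ (Finset.sum_congr rfl fun a _ => ?_)
  rw [spinCov_chiralExp cov hm hl hψ, map_add, map_add, map_smul, map_smul,
    DiracMatrices.gamma_chiralExp hm, DiracMatrices.grading_chiralExp,
    DiracMatrices.gamma_chiralExp hm]

/-! ### Boundedness of the Clifford action of a smooth differential -/

theorem continuousOn_mvfderiv_frame {l : M → ℝ} (hl : ContMDiff 𝓘(ℝ, Model m) 𝓘(ℝ, ℝ) ∞ l)
    (i : Fin S.k) (a : Fin (2 * m)) :
    ContinuousOn (fun x => mvfderiv 𝓘(ℝ, Model m) l x (S.frame i a x)) (S.U i) := by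
  have h := (hl.continuous_tangentMap (by simp)).comp_continuousOn (S.frame_smooth i a).continuousOn
  exact (continuous_snd.comp
    (tangentBundleModelSpaceHomeomorph 𝓘(ℝ, ℝ)).continuous).comp_continuousOn h

/-- Comparison of the components of a covector in two orthonormal frames. -/
theorem abs_frame_le {i j : Fin S.k} {x : M} (hi : x ∈ S.U i) (hj : x ∈ S.U j)
    (η : TangentSpace 𝓘(ℝ, Model m) x →L[ℝ] ℝ) (a : Fin (2 * m)) :
    |η (S.frame i a x)| ≤ ∑ b, |η (S.frame j b x)| := by
  have : FiniteDimensional ℝ (TangentSpace 𝓘(ℝ, Model m) x) :=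
    inferInstanceAs (FiniteDimensional ℝ (Model m))
  have hcard : Fintype.card (Fin (2 * m)) =
      Module.finrank ℝ (TangentSpace 𝓘(ℝ, Model m) x) := by
    rw [Fintype.card_fin]
    exact finrank_euclideanSpace_fin.symm
  have hspan := (S.frame_orthonormal j x hj).linearIndependent.span_eq_top_of_card_eq_finrank' hcard
  let b := OrthonormalBasis.mk (S.frame_orthonormal j x hj) hspan.ge
  have hb : ∀ c, b c = S.frame j c x := fun c => by simp [b]
  rw [← b.sum_repr' (S.frame i a x), map_sum]
  refine (Finset.abs_sum_le_sum_abs _ _).trans (Finset.sum_le_sum fun c _ => ?_)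
  rw [map_smul, smul_eq_mul, abs_mul, hb]
  refine mul_le_of_le_one_left (abs_nonneg _) ((abs_real_inner_le_norm _ _).trans ?_)
  rw [(S.frame_orthonormal j x hj).1 c, (S.frame_orthonormal i x hi).1 a, one_mul]

/-- The components of a smooth differential in the chosen frames are bounded. They need not be
continuous, since the choice of the frame jumps, but near each point they are controlled by the
components in one fixed frame. -/
theorem exists_abs_mvfderiv_frame_le [CompactSpace M] {l : M → ℝ}
    (hl : ContMDiff 𝓘(ℝ, Model m) 𝓘(ℝ, ℝ) ∞ l) :
    ∃ C : ℝ, ∀ x a, |mvfderiv 𝓘(ℝ, Model m) l x (S.frame (S.idx x) a x)| ≤ C := by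
  have key : ∃ C : ℝ, ∀ x ∈ (Set.univ : Set M), ∀ a,
      |mvfderiv 𝓘(ℝ, Model m) l x (S.frame (S.idx x) a x)| ≤ C := by
    refine isCompact_univ.induction_on (p := fun s => ∃ C : ℝ, ∀ x ∈ s, ∀ a,
      |mvfderiv 𝓘(ℝ, Model m) l x (S.frame (S.idx x) a x)| ≤ C) ⟨0, by simp⟩ ?_ ?_ ?_
    · rintro s t hst ⟨C, hC⟩
      exact ⟨C, fun x hx => hC x (hst hx)⟩
    · rintro s t ⟨C, hC⟩ ⟨C', hC'⟩
      refine ⟨max C C', fun x hx a => ?_⟩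
      rcases hx with hx | hx
      · exact (hC x hx a).trans (le_max_left _ _)
      · exact (hC' x hx a).trans (le_max_right _ _)
    · intro x _
      have hU := (S.isOpen_U (S.idx x)).mem_nhds (S.mem_idx x)
      have hcont : ContinuousAt (fun y => ∑ b,
          |mvfderiv 𝓘(ℝ, Model m) l y (S.frame (S.idx x) b y)|) x :=
        (continuousOn_finsetSum _ fun b _ =>
          (continuousOn_mvfderiv_frame hl (S.idx x) b).abs).continuousAt hU
      obtain ⟨C, hC⟩ := exists_gt (∑ b, |mvfderiv 𝓘(ℝ, Model m) l x (S.frame (S.idx x) b x)|)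
      refine ⟨_, mem_nhdsWithin_of_mem_nhds (Filter.inter_mem hU
        (hcont.eventually_lt continuousAt_const hC)), C, fun y hy a => ?_⟩
      exact (abs_frame_le (S.mem_idx y) hy.1 _ a).trans (le_of_lt hy.2)
  exact key.imp fun C hC x => hC x trivial

theorem norm_cliff_le {x : M}
    {η : TangentSpace 𝓘(ℝ, Model m) x →L[ℝ] ℝ} {C : ℝ}
    (hη : ∀ a, |η (S.frame (S.idx x) a x)| ≤ C) : ‖S.cliff x η‖ ≤ ∑ a, C * ‖R.gamma a‖ := by
  rw [cliff]
  refine norm_sum_le_of_le _ fun a _ => ?_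
  have h := ContinuousLinearMap.opNorm_smul_le ((η (S.frame (S.idx x) a x) : ℝ) : ℂ) (R.gamma a)
  rw [Complex.norm_real, Real.norm_eq_abs] at h
  exact h.trans (mul_le_mul_of_nonneg_right (hη a) (norm_nonneg _))

theorem measurableSet_idx_eq [MeasurableSpace M] [BorelSpace M] (i : Fin S.k) :
    MeasurableSet {x | S.idx x = i} := by
  have h : {x | S.idx x = i} = S.U i ∩ ⋂ j, ⋂ (_ : j < i), (S.U j)ᶜ := by
    ext x
    simp only [Set.mem_ofPred_eq, Set.mem_inter_iff, Set.mem_iInter, Set.mem_compl_iff]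
    constructor
    · rintro rfl
      exact ⟨S.mem_idx x, fun j hj hx =>
        (wellFounded_lt (α := Fin S.k)).not_lt_min {i | x ∈ S.U i} hx hj⟩
    · rintro ⟨hx, hlt⟩
      refine le_antisymm (not_lt.1 fun h => ?_) (not_lt.1 fun h => hlt _ h (S.mem_idx x))
      exact (wellFounded_lt (α := Fin S.k)).not_lt_min {i | x ∈ S.U i} hx h
  rw [h]
  exact (S.isOpen_U i).measurableSet.inter
    (.iInter fun j => .iInter fun _ => (S.isOpen_U j).measurableSet.compl)

theorem measurable_mvfderiv_frame [MeasurableSpace M] [BorelSpace M] {l : M → ℝ}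
    (hl : ContMDiff 𝓘(ℝ, Model m) 𝓘(ℝ, ℝ) ∞ l) (a : Fin (2 * m)) :
    Measurable (fun x => mvfderiv 𝓘(ℝ, Model m) l x (S.frame (S.idx x) a x)) := by
  classical
  have h : (fun x => mvfderiv 𝓘(ℝ, Model m) l x (S.frame (S.idx x) a x)) = fun x =>
      ∑ i, {x | S.idx x = i}.indicator ((S.U i).piecewise
        (fun x => mvfderiv 𝓘(ℝ, Model m) l x (S.frame i a x)) fun _ => 0) x := by
    ext1 x
    rw [Finset.sum_eq_single (S.idx x)]
    · rw [Set.indicator_of_mem (by rfl), Set.piecewise_eq_of_mem _ _ _ (S.mem_idx x)]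
    · intro i _ hi
      exact Set.indicator_of_notMem (fun h => hi h.symm) _
    · simp
  rw [h]
  exact Finset.measurable_sum _ fun i _ => ((continuousOn_mvfderiv_frame hl i a).measurable_piecewise
    continuousOn_const (S.isOpen_U i).measurableSet).indicator (measurableSet_idx_eq i)

end SpinStructure

end Spinors

/-! ### The twisted unitaries -/

section TwistedUnitary

variable {m : ℕ} {M : Type*} [TopologicalSpace M] [ChartedSpace (Model m) M]

/-- The function `ln |h|²`. -/
noncomputable def logNormSq (h : SmoothFun m M) (x : M) : ℝ := Real.log (‖h x‖ ^ 2)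

theorem contMDiff_logNormSq {h : SmoothFun m M} (hh : ∀ x, h x ≠ 0) :
    ContMDiff 𝓘(ℝ, Model m) 𝓘(ℝ, ℝ) ∞ (logNormSq h) := fun x => by
  have h1 : ContDiffAt ℝ ∞ (fun z : ℂ => Real.log (‖z‖ ^ 2)) (h x) :=
    (contDiff_norm_sq ℝ).contDiffAt.log (pow_ne_zero 2 (norm_ne_zero_iff.2 (hh x)))
  exact h1.comp_contMDiffAt (h.contMDiff x)

theorem logNormSq_invFun {h : SmoothFun m M} (hh : ∀ x, h x ≠ 0) (x : M) :
    logNormSq (invFun h hh) x = -logNormSq h x := by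
  change Real.log (‖(h x)⁻¹‖ ^ 2) = -Real.log (‖h x‖ ^ 2)
  rw [norm_inv, inv_pow, Real.log_inv]

theorem isTwistedUnitary_twistedUnitary (h : SmoothFun m M) (hh : ∀ x, h x ≠ 0) :
    IsTwistedUnitary (twistedUnitary h hh) := by
  have hc : ∀ x, starRingEnd ℂ (h x) ≠ 0 := fun x => by simpa using hh x
  refine ⟨Prod.ext (ContMDiffMap.ext fun x => ?_) (ContMDiffMap.ext fun x => ?_),
    Prod.ext (ContMDiffMap.ext fun x => ?_) (ContMDiffMap.ext fun x => ?_)⟩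
  · change starRingEnd ℂ (starRingEnd ℂ (h x))⁻¹ * h x = 1
    rw [map_inv₀, Complex.conj_conj, inv_mul_cancel₀ (hh x)]
  · change starRingEnd ℂ (h x) * (starRingEnd ℂ (h x))⁻¹ = 1
    rw [mul_inv_cancel₀ (hc x)]
  · change h x * starRingEnd ℂ (starRingEnd ℂ (h x))⁻¹ = 1
    rw [map_inv₀, Complex.conj_conj, mul_inv_cancel₀ (hh x)]
  · change (starRingEnd ℂ (h x))⁻¹ * starRingEnd ℂ (h x) = 1
    rw [inv_mul_cancel₀ (hc x)]

end TwistedUnitary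

/-! ### Bounded fields of matrices -/

section Operators

variable {m : ℕ} {R : DiracMatrices m} {M : Type*} [TopologicalSpace M] [ChartedSpace (Model m) M]
  [IsManifold 𝓘(ℝ, Model m) ∞ M]
  [RiemannianBundle (fun x : M => TangentSpace 𝓘(ℝ, Model m) x)]
  [MeasurableSpace M] (S : SpinStructure R M)

/-- Multiplication by a bounded measurable field of matrices is everywhere defined and bounded. -/
theorem exists_mulOp_eq_toPMap {A : M → (Spinor m →L[ℂ] Spinor m)}
    (hA : AEStronglyMeasurable A (riemannianVolume m M)) {C : ℝ} (hC : ∀ x, ‖A x‖ ≤ C) :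
    ∃ T : L2Spinor S →L[ℂ] L2Spinor S, mulOp S A = (T : L2Spinor S →ₗ[ℂ] L2Spinor S).toPMap ⊤ ∧
      ∀ ψ, T ψ =ᵐ[riemannianVolume m M] fun x => A x (ψ x) := by
  have hle : ∀ (ψ : L2Spinor S) x, ‖A x (ψ x)‖ ≤ C * ‖ψ x‖ := fun ψ x =>
    ((A x).le_opNorm _).trans (mul_le_mul_of_nonneg_right (hC x) (norm_nonneg _))
  have hmem : ∀ ψ : L2Spinor S, MemLp (fun x => A x (ψ x)) 2 (riemannianVolume m M) := fun ψ =>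
    MemLp.of_le_mul (c := C) (Lp.memLp ψ)
      ((ContinuousLinearMap.id ℂ (Spinor m →L[ℂ] Spinor m)).aestronglyMeasurable_comp₂ hA
        (Lp.aestronglyMeasurable ψ)) (.of_forall (hle ψ))
  let T : L2Spinor S →L[ℂ] L2Spinor S := LinearMap.mkContinuous
    { toFun := fun ψ => applyLp S A ψ (hmem ψ)
      map_add' := fun ψ φ => applyLp_add S A ψ φ _ _ _
      map_smul' := fun c ψ => applyLp_smul S A c ψ _ _ } C fun ψ => by
        refine Lp.norm_le_mul_norm_of_ae_le_mul ?_
        filter_upwards [MemLp.coeFn_toLp (hmem ψ)] with x hx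
        exact (le_of_eq (congrArg norm hx)).trans (hle ψ x)
  refine ⟨T, ?_, fun ψ => MemLp.coeFn_toLp (hmem ψ)⟩
  refine LinearPMap.ext (Submodule.ext fun ψ => ⟨fun _ => trivial, fun _ => hmem ψ⟩) ?_
  intro ψ h1 h2
  rfl

theorem mulCLM_coeFn [CompactSpace M] [BorelSpace M] (A : C(M, Spinor m →L[ℂ] Spinor m))
    (ψ : L2Spinor S) : mulCLM S A ψ =ᵐ[riemannianVolume m M] fun x => A x (ψ x) :=
  MemLp.coeFn_toLp (memLp_apply S A ψ)

theorem repAlg_coeFn [CompactSpace M] [BorelSpace M] (a : TwistAlg m M) (ψ : L2Spinor S) :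
    repAlg S a ψ =ᵐ[riemannianVolume m M] fun x => R.chiral (a.1 x) (a.2 x) (ψ x) :=
  mulCLM_coeFn S _ ψ

/-! ### The adjoint action of `u_h` -/

variable [CompactSpace M] [BorelSpace M]

/-- Since `𝒥` commutes with `γ`, `𝒥 π(h, 1/h̄) 𝒥⁻¹ = π(h̄, 1/h)`, so that `Ad(u_h)` is
multiplication by `π(|h|², |h|⁻²) = exp (ln |h|² γ)`. -/
theorem adAction_coeFn (hm : Even m) (h : SmoothFun m M) (hh : ∀ x, h x ≠ 0) (ψ : L2Spinor S) :
    adAction S (twistedUnitary h hh) ψ =ᵐ[riemannianVolume m M]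
      fun x => R.chiralExp (logNormSq h x) (ψ x) := by
  filter_upwards [repAlg_coeFn S (twistedUnitary h hh) (realStructure S
      (repAlg S (twistedUnitary h hh) ((realStructure S).symm ψ))),
    pointwiseConj_coeFn S R.chargeConj (repAlg S (twistedUnitary h hh) ((realStructure S).symm ψ)),
    repAlg_coeFn S (twistedUnitary h hh) ((realStructure S).symm ψ),
    pointwiseConj_coeFn S R.chargeConj.symm ψ] with x h1 h2 h3 h4
  have h4' : (realStructure S).symm ψ x = R.chargeConj.symm (ψ x) := h4
  rw [h4'] at h3
  have h2' : realStructure S (repAlg S (twistedUnitary h hh) ((realStructure S).symm ψ)) x =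
      R.chargeConj (repAlg S (twistedUnitary h hh) ((realStructure S).symm ψ) x) := h2
  rw [h2', h3, DiracMatrices.chargeConj_chiral hm, LinearIsometryEquiv.apply_symm_apply,
    DiracMatrices.chiral_chiral_apply hm] at h1
  refine h1.trans ?_
  have hpos : 0 < ‖h x‖ ^ 2 := pow_pos (norm_pos_iff.2 (hh x)) 2
  have e1 : h x * starRingEnd ℂ (h x) = (Real.exp (logNormSq h x) : ℝ) := by
    rw [logNormSq, Real.exp_log hpos, Complex.mul_conj, Complex.normSq_eq_norm_sq]
  have e2 : (starRingEnd ℂ (h x))⁻¹ * starRingEnd ℂ (starRingEnd ℂ (h x))⁻¹ =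
      (Real.exp (-logNormSq h x) : ℝ) := by
    rw [map_inv₀, Complex.conj_conj, ← mul_inv, mul_comm, e1, Real.exp_neg, Complex.ofReal_inv]
  change R.chiral (h x * starRingEnd ℂ (h x))
    ((starRingEnd ℂ (h x))⁻¹ * starRingEnd ℂ (starRingEnd ℂ (h x))⁻¹) (ψ x) = _
  rw [e1, e2]
  rfl

theorem adjoint_adAction (hm : Even m) (h : SmoothFun m M) (hh : ∀ x, h x ≠ 0) :
    ContinuousLinearMap.adjoint (adAction S (twistedUnitary h hh)) =
      adAction S (twistedUnitary h hh) := by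
  refine ((ContinuousLinearMap.eq_adjoint_iff _ _).2 fun ψ φ => ?_).symm
  rw [L2.inner_def, L2.inner_def]
  refine integral_congr_ae ?_
  filter_upwards [adAction_coeFn S hm h hh ψ, adAction_coeFn S hm h hh φ] with x h1 h2
  rw [h1, h2, DiracMatrices.inner_chiralExp hm]

theorem adAction_invFun_adAction (hm : Even m) (h : SmoothFun m M) (hh : ∀ x, h x ≠ 0)
    (hh' : ∀ x, invFun h hh x ≠ 0) (ψ : L2Spinor S) :
    adAction S (twistedUnitary (invFun h hh) hh') (adAction S (twistedUnitary h hh) ψ) = ψ := by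
  refine Lp.ext ?_
  filter_upwards [adAction_coeFn S hm h hh ψ, adAction_coeFn S hm (invFun h hh) hh'
    (adAction S (twistedUnitary h hh) ψ)] with x h1 h2
  rw [h2, h1, logNormSq_invFun, DiracMatrices.chiralExp_neg_apply hm]

theorem adAction_adAction_invFun (hm : Even m) (h : SmoothFun m M) (hh : ∀ x, h x ≠ 0)
    (hh' : ∀ x, invFun h hh x ≠ 0) (ψ : L2Spinor S) :
    adAction S (twistedUnitary h hh) (adAction S (twistedUnitary (invFun h hh) hh') ψ) = ψ := by
  refine Lp.ext ?_
  filter_upwards [adAction_coeFn S hm (invFun h hh) hh' ψ, adAction_coeFn S hm h hh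
    (adAction S (twistedUnitary (invFun h hh) hh') ψ)] with x h1 h2
  rw [h2, h1, logNormSq_invFun, DiracMatrices.chiralExp_apply_neg hm]

/-- `Ad(u_h)` is invertible, with inverse `Ad(u_{1/h})`. -/
noncomputable def adEquiv (hm : Even m) (h : SmoothFun m M) (hh : ∀ x, h x ≠ 0) :
    L2Spinor S ≃L[ℂ] L2Spinor S :=
  ContinuousLinearEquiv.equivOfInverse (adAction S (twistedUnitary h hh))
    (adAction S (twistedUnitary (invFun h hh) fun x => inv_ne_zero (hh x)))
    (adAction_invFun_adAction S hm h hh _) (adAction_adAction_invFun S hm h hh _)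

theorem coe_adEquiv (hm : Even m) (h : SmoothFun m M) (hh : ∀ x, h x ≠ 0) :
    (adEquiv S hm h hh : L2Spinor S →L[ℂ] L2Spinor S) = adAction S (twistedUnitary h hh) := rfl

theorem adEquiv_coeFn (hm : Even m) (h : SmoothFun m M) (hh : ∀ x, h x ≠ 0) (ψ : L2Spinor S) :
    adEquiv S hm h hh ψ =ᵐ[riemannianVolume m M] fun x => R.chiralExp (logNormSq h x) (ψ x) :=
  adAction_coeFn S hm h hh ψ

theorem adEquiv_symm_coeFn (hm : Even m) (h : SmoothFun m M) (hh : ∀ x, h x ≠ 0) (ψ : L2Spinor S) :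
    (adEquiv S hm h hh).symm ψ =ᵐ[riemannianVolume m M]
      fun x => R.chiralExp (-logNormSq h x) (ψ x) := by
  refine (adAction_coeFn S hm (invFun h hh) (fun x => inv_ne_zero (hh x)) ψ).trans ?_
  simp_rw [logNormSq_invFun]
  rfl

/-! ### The additional term -/

/-- The additional term is an everywhere defined bounded operator: the components of `d (ln |h|²)`
in the chosen frames are measurable and bounded. -/
theorem exists_torsionTerm_eq_toPMap (h : SmoothFun m M) (hh : ∀ x, h x ≠ 0) :
    ∃ T : L2Spinor S →L[ℂ] L2Spinor S,
      torsionTerm S (dLogNormSq h) = (T : L2Spinor S →ₗ[ℂ] L2Spinor S).toPMap ⊤ ∧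
      ∀ ψ, T ψ =ᵐ[riemannianVolume m M] fun x => ((-Complex.I) •
        (S.cliff x (mvfderiv 𝓘(ℝ, Model m) (logNormSq h) x) * R.grading)) (ψ x) := by
  have hl := contMDiff_logNormSq hh
  obtain ⟨C, hC⟩ := S.exists_abs_mvfderiv_frame_le hl
  have hmeas : AEStronglyMeasurable
      (fun x => S.cliff x (mvfderiv 𝓘(ℝ, Model m) (logNormSq h) x)) (riemannianVolume m M) := by
    have h (a : Fin (2 * m)) : AEStronglyMeasurable
        (fun x => ((mvfderiv 𝓘(ℝ, Model m) (logNormSq h) x (S.frame (S.idx x) a x) : ℝ) : ℂ) •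
          R.gamma a) (riemannianVolume m M) :=
      (Complex.measurable_ofReal.comp
        (SpinStructure.measurable_mvfderiv_frame hl a)).aestronglyMeasurable.smul_const _
    exact Finset.aestronglyMeasurable_fun_sum _ fun a _ => h a
  have hbound (x : M) : ‖S.cliff x (mvfderiv 𝓘(ℝ, Model m) (logNormSq h) x)‖ ≤
      ∑ a, C * ‖R.gamma a‖ := SpinStructure.norm_cliff_le (hC x)
  refine exists_mulOp_eq_toPMap S ?_ (C := ‖-Complex.I‖ * ((∑ a, C * ‖R.gamma a‖) * ‖R.grading‖))
    fun x => ?_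
  · exact (hmeas.mul_const R.grading).const_smul (-Complex.I)
  · refine (norm_smul_le (-Complex.I) (S.cliff x (dLogNormSq h x) * R.grading)).trans
      (mul_le_mul_of_nonneg_left ?_ (norm_nonneg _))
    exact (norm_mul_le _ _).trans (mul_le_mul_of_nonneg_right (hbound x) (norm_nonneg _))

/-! ### The twisted fluctuation of the Dirac operator -/

variable [IsContMDiffRiemannianBundle 𝓘(ℝ, Model m) ∞ (Model m)
    (fun x : M => TangentSpace 𝓘(ℝ, Model m) x)]
  (cov : CovariantDerivative 𝓘(ℝ, Model m) (Model m)
    (fun x : M => TangentSpace 𝓘(ℝ, Model m) x))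

/-- The formula on smooth spinors, as an equality of graphs: if `φ` is smooth and `ψ = e^{λγ} φ`
with `λ = ln |h|²`, then `e^{λγ} D ψ = D φ - i γ^μ (∂_μ λ) γ φ`. -/
theorem sandwich_diracSmooth (hm : Even m) (h : SmoothFun m M) (hh : ∀ x, h x ≠ 0) :
    sandwich (adEquiv S hm h hh : L2Spinor S →L[ℂ] L2Spinor S) (diracSmooth S cov)
        (adEquiv S hm h hh : L2Spinor S →L[ℂ] L2Spinor S) =
      diracSmooth S cov + torsionTerm S (dLogNormSq h) := by
  obtain ⟨T, hT, hTψ⟩ := exists_torsionTerm_eq_toPMap S h hh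
  have hl := contMDiff_logNormSq hh
  rw [hT]
  refine LinearPMap.eq_of_eq_graph ?_
  rw [sandwich_graph, add_toPMap_graph, diracSmooth,
    Submodule.toLinearPMap_graph_eq _ (diracGraph_functional S cov)]
  set B := adEquiv S hm h hh
  refine le_antisymm ?_ ?_
  · rintro _ ⟨q, ⟨ψ, hψ, h1, h2⟩, rfl⟩
    have hφ := hψ.chiralExp hm hl.neg
    set φ : M → Spinor m := fun x => R.chiralExp (-logNormSq h x) (ψ x)
    have hφψ : (fun x => R.chiralExp (logNormSq h x) (φ x)) = ψ :=
      funext fun x => DiracMatrices.chiralExp_apply_neg hm _ _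
    have hD := SpinStructure.diracSection_chiralExp cov hm hl hφ
    have h3 : B.symm q.1 =ᵐ[riemannianVolume m M] φ := by
      filter_upwards [adEquiv_symm_coeFn S hm h hh q.1, h1] with x h3 h4
      rw [h3, h4]
    refine ⟨(B.symm q.1, B q.2 - T (B.symm q.1)), ⟨φ, hφ, h3, ?_⟩, Prod.ext rfl ?_⟩
    · filter_upwards [Lp.coeFn_sub (B q.2) (T (B.symm q.1)), adEquiv_coeFn S hm h hh q.2, h2,
        hTψ (B.symm q.1), h3] with x e1 e2 e3 e4 e5
      rw [e1, Pi.sub_apply, e2, e3, e4, e5, ← hφψ, hD, DiracMatrices.chiralExp_apply_neg hm,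
        add_sub_cancel_right]
    · exact sub_add_cancel _ _
  · rintro _ ⟨p, ⟨φ, hφ, h1, h2⟩, rfl⟩
    have hD := SpinStructure.diracSection_chiralExp cov hm hl hφ
    refine ⟨(B p.1, B.symm (p.2 + T p.1)), ⟨_, hφ.chiralExp hm hl, ?_, ?_⟩,
      Prod.ext (B.symm_apply_apply _) (B.apply_symm_apply _)⟩
    · filter_upwards [adEquiv_coeFn S hm h hh p.1, h1] with x e1 e2
      rw [e1, e2]
    · filter_upwards [adEquiv_symm_coeFn S hm h hh (p.2 + T p.1), Lp.coeFn_add p.2 (T p.1),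
        hTψ p.1, h1, h2] with x e1 e2 e3 e4 e5
      rw [e1, e2, Pi.add_apply, e3, e4, e5, hD]

end Operators

end TwistedDirac

theorem mainTheorem3 {m : ℕ} (hKO : koDimension m = 0 ∨ koDimension m = 4)
    {M : Type*} [TopologicalSpace M] [T2Space M] [CompactSpace M]
    [ChartedSpace (Model m) M] [IsManifold 𝓘(ℝ, Model m) ∞ M]
    [RiemannianBundle (fun x : M => TangentSpace 𝓘(ℝ, Model m) x)]
    [IsContMDiffRiemannianBundle 𝓘(ℝ, Model m) ∞ (Model m)
      (fun x : M => TangentSpace 𝓘(ℝ, Model m) x)]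
    [MeasurableSpace M] [BorelSpace M]
    (R : DiracMatrices m) (S : SpinStructure R M)
    (cov : CovariantDerivative 𝓘(ℝ, Model m) (Model m)
      (fun x : M => TangentSpace 𝓘(ℝ, Model m) x)) (hcov : IsLeviCivita cov)
    (h : SmoothFun m M) (hh : ∀ x, h x ≠ 0) :
    IsTwistedUnitary (twistedUnitary h hh) ∧
    sandwich (adAction S (twistedUnitary h hh)) (diracSmooth S cov)
        (ContinuousLinearMap.adjoint (adAction S (twistedUnitary h hh))) =
      diracSmooth S cov + torsionTerm S (dLogNormSq h) ∧
    sandwich (adAction S (twistedUnitary h hh)) (dirac S cov)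
        (ContinuousLinearMap.adjoint (adAction S (twistedUnitary h hh))) =
      dirac S cov + torsionTerm S (dLogNormSq h) := by
  have hm : Even m := by
    rw [Nat.even_iff]
    unfold koDimension at hKO
    omega
  have hsmooth := sandwich_diracSmooth S cov hm h hh
  rw [adjoint_adAction S hm, ← coe_adEquiv S hm]
  refine ⟨isTwistedUnitary_twistedUnitary h hh, hsmooth, ?_⟩
  obtain ⟨T, hT, -⟩ := exists_torsionTerm_eq_toPMap S h hh
  rw [dirac, ← sandwich_closure, hsmooth, hT, add_toPMap_closure]
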